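/- Let $(N,g)$ be a compact connected smooth Riemannian manifold without boundary, of dimension $n \ge 1$, with diameter $D$. Let $S$ be a continuous symmetric $(0,2)$-tensor field on $N$ that is positive definite at every point, and let $\lambda_{\max}(S)$ be the maximum over $N$ of the eigenvalues of $S$ with respect to $g$. Suppose that $$\lambda_{\max}(S)\, D^2 < \frac{\pi^2}{2}.$$ Then there is a constant $C$, depending only on $(N,g)$ and $S$, such that every $C^2$ function $u : N \to \mathbb{R}$ that solves $$\det{}^{1/n}\Big(\nabla^2 u + du \otimes du - \frac{|\nabla u|^2}{2}\, g + S\Big) = e^{-2u} \quad \text{on } N$$ satisfies $|u| \le C$ on $N$. Here $\nabla^2 u$ is the Hessian of $u$ for the Levi-Civita connection of $g$, and the determinant of a symmetric $(0,2)$-tensor is the product of its eigenvalues with respect to $g$; being a solution includes that this determinant is nonnegative, so that its $n$-th root is defined. -/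

import Mathlib

open Bundle Manifold
open scoped ContDiff

noncomputable section

namespace ConformalDet

section LinearAlgebra

variable {V : Type*} [NormedAddCommGroup V] [InnerProductSpace ℝ V] [FiniteDimensional ℝ V]

/-- The vector `ℓ♯` that represents a linear form `ℓ`, i.e. `⟪ℓ♯, w⟫ = ℓ w` for all `w`. -/
def sharp (l : V →L[ℝ] ℝ) : V :=
  haveI : CompleteSpace V := FiniteDimensional.complete ℝ V
  (InnerProductSpace.toDual ℝ V).symm l

/-- The linear transformation of `V` that corresponds to a bilinear form `B`
under the inner product, i.e. `⟪B♯ v, w⟫ = B v w` for all `v`, `w`. -/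
def toEndo (B : V →L[ℝ] V →L[ℝ] ℝ) : V →L[ℝ] V :=
  haveI : CompleteSpace V := FiniteDimensional.complete ℝ V
  InnerProductSpace.continuousLinearMapOfBilin (𝕜 := ℝ) B

theorem inner_sharp (l : V →L[ℝ] ℝ) (w : V) : inner ℝ (sharp l) w = l w := by
  have : CompleteSpace V := FiniteDimensional.complete ℝ V
  simp [sharp]

theorem inner_toEndo (B : V →L[ℝ] V →L[ℝ] ℝ) (v w : V) :
    inner ℝ (toEndo B v) w = B v w := by
  have : CompleteSpace V := FiniteDimensional.complete ℝ V
  exact InnerProductSpace.continuousLinearMapOfBilin_apply (𝕜 := ℝ) B v w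

end LinearAlgebra

variable {n : ℕ} {N : Type*} [TopologicalSpace N] [ChartedSpace (EuclideanSpace ℝ (Fin n)) N]

instance instFiniteDimensionalTangentSpace (x : N) :
    FiniteDimensional ℝ (TangentSpace (𝓡 n) x) :=
  inferInstanceAs (FiniteDimensional ℝ (EuclideanSpace ℝ (Fin n)))

/-- A field of bilinear forms on the tangent spaces, i.e. a tensor field of type `(0,2)`. -/
abbrev TwoTensor (n : ℕ) (N : Type*) [TopologicalSpace N]
    [ChartedSpace (EuclideanSpace ℝ (Fin n)) N] :=
  ∀ x : N, TangentSpace (𝓡 n) x →L[ℝ] TangentSpace (𝓡 n) x →L[ℝ] ℝ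

variable [RiemannianBundle (fun x : N ↦ TangentSpace (𝓡 n) x)]

/-- The Riemannian metric `g` as a tensor field. -/
def metricTensor : TwoTensor n N := fun x ↦ innerSL ℝ (E := TangentSpace (𝓡 n) x)

/-- The Riemannian metric in the preferred chart at `x`: the pullback of `g` under the inverse of
the chart. In coordinates, this is the matrix `(g_{ij})` as a function on the chart's target. -/
def chartMetric (x : N) (y : EuclideanSpace ℝ (Fin n)) :
    EuclideanSpace ℝ (Fin n) →L[ℝ] EuclideanSpace ℝ (Fin n) →L[ℝ] ℝ :=
  let L : EuclideanSpace ℝ (Fin n) →L[ℝ] TangentSpace (𝓡 n) ((extChartAt (𝓡 n) x).symm y) :=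
    mfderiv (𝓡 n) (𝓡 n) (extChartAt (𝓡 n) x).symm y
  (metricTensor ((extChartAt (𝓡 n) x).symm y)).bilinearComp L L

/-- The Christoffel symbol of the first kind at `x`, in the preferred chart at `x`, contracted
with `z` in its last slot: `Γ(v, w; z) = ½ (∂_v g(w, z) + ∂_w g(v, z) - ∂_z g(v, w))`. -/
def christoffel (x : N) (z : EuclideanSpace ℝ (Fin n)) :
    EuclideanSpace ℝ (Fin n) →L[ℝ] EuclideanSpace ℝ (Fin n) →L[ℝ] ℝ :=
  let dG := fderiv ℝ (chartMetric x) (extChartAt (𝓡 n) x x)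
  (1 / 2 : ℝ) • (dG.flip z + (dG.flip z).flip - dG z)

/-- The differential `du`. -/
def differential (n : ℕ) {N : Type*} [TopologicalSpace N]
    [ChartedSpace (EuclideanSpace ℝ (Fin n)) N] (u : N → ℝ) (x : N) : TangentSpace (𝓡 n) x →L[ℝ] ℝ :=
  mfderiv (𝓡 n) 𝓘(ℝ, ℝ) u x

/-- The gradient `∇u`. -/
def grad (n : ℕ) {N : Type*} [TopologicalSpace N] [ChartedSpace (EuclideanSpace ℝ (Fin n)) N]
    [RiemannianBundle (fun x : N ↦ TangentSpace (𝓡 n) x)] (u : N → ℝ) (x : N) : TangentSpace (𝓡 n) x :=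
  sharp (differential n u x)

/-- The Hessian `∇²u` with respect to the Levi-Civita connection,
`(∇²u)_{ij} = ∂_i ∂_j u - Γ_{ij}^k ∂_k u`. At the point `x` it is computed in the preferred chart
at `x`, through which Mathlib identifies the tangent space at `x` with `ℝⁿ`. The last term is
written as `Γ_{ij}^k ∂_k u = Γ_{ijl} (∇u)^l` with the Christoffel symbols of the first kind. -/
def hessian (u : N → ℝ) : TwoTensor n N := fun x ↦
  let f : EuclideanSpace ℝ (Fin n) → ℝ := u ∘ (extChartAt (𝓡 n) x).symm
  (fderiv ℝ (fderiv ℝ f) (extChartAt (𝓡 n) x x) - christoffel x (grad n u x) :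
    EuclideanSpace ℝ (Fin n) →L[ℝ] EuclideanSpace ℝ (Fin n) →L[ℝ] ℝ)

/-- The tensor `∇²u + du ⊗ du - ½ |∇u|² g + S`. -/
def conformalHessian (S : TwoTensor n N) (u : N → ℝ) : TwoTensor n N := fun x ↦
  hessian u x + (differential n u x).smulRight (differential n u x)
    - (‖grad n u x‖ ^ 2 / 2) • metricTensor x + S x

/-- `u` is a `C²` solution of `det^{1/n} (∇²u + du ⊗ du - ½ |∇u|² g + S) = e^{-2u}`. The
determinant of the tensor is that of the corresponding endomorphism of the tangent space, i.e.
the product of its eigenvalues with respect to `g`; it has to be nonnegative for the `n`-th root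
to make sense. -/
def IsSolution (S : TwoTensor n N) (u : N → ℝ) : Prop :=
  ContMDiff (𝓡 n) 𝓘(ℝ, ℝ) 2 u ∧
    ∀ x : N, 0 ≤ (toEndo (conformalHessian S u x)).det ∧
      (toEndo (conformalHessian S u x)).det ^ (1 / n : ℝ) = Real.exp (-2 * u x)

/-- The tensor field is continuous. -/
def IsContinuousTensor (S : TwoTensor n N) [IsManifold (𝓡 n) 1 N] : Prop :=
  Continuous fun x : N ↦
    TotalSpace.mk' (EuclideanSpace ℝ (Fin n) →L[ℝ] EuclideanSpace ℝ (Fin n) →L[ℝ] ℝ)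
      (E := fun x : N ↦ TangentSpace (𝓡 n) x →L[ℝ] TangentSpace (𝓡 n) x →L[ℝ] ℝ) x (S x)

/-- `λ_max(S)`: the maximum over `N` of the eigenvalues of `S` with respect to `g`. -/
def lambdaMax (S : TwoTensor n N) : ℝ :=
  sSup {l : ℝ | ∃ x : N, Module.End.HasEigenvalue (toEndo (S x)).toLinearMap l}

end ConformalDet

end

/-! Write A for the tensor under the determinant, l for λ_max(S), M for max u.

Positivity. At a minimum of u, A ≥ S > 0. The determinant never vanishes, since its root is an
exponential, so the set where A is positive definite is open and closed; as N is connected, it is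
all of N (`conformalHessian_isPosDefAt`).

One-sided bounds. At the minimum A ≥ S ≥ c g, and at the maximum 0 < A ≤ S ≤ l g. Comparing
determinants bounds min u above and max u below (`one_sided_bounds`).

Gradient estimate. Maximize exp u (|∇u|² + 2l). Were ∇u nonzero at the maximum, the first order
condition along ∇u would give A(∇u, ∇u) = S(∇u, ∇u) - l |∇u|² ≤ 0, against positivity. So the
maximum is at most 2l exp M, which is |∇u|² ≤ 2l (exp(M - u) - 1) (`norm_grad_sq_le`). No second
derivative of |∇u|² is needed, so C² suffices.

Harnack inequality. The estimate makes arccos(exp((u - M)/2)) Lipschitz with constant √(l/2). It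
vanishes where u = M, hence is at most d = √(l/2) D, and the hypothesis says precisely d < π/2.
Taking cosines, M ≤ u - 2 log cos d (`le_add_of_norm_grad_sq_le`). This bound on the oscillation and
the one-sided bounds together control |u|. -/

namespace ConformalDet

open Filter Topology Set

set_option synthInstance.maxHeartbeats 400000
set_option maxHeartbeats 1000000

/-! ### Symmetric bilinear forms, their eigenvalues and determinants. -/

section Forms

variable {V : Type*} [NormedAddCommGroup V] [InnerProductSpace ℝ V] [FiniteDimensional ℝ V]

theorem isSymmetric_toEndo {B : V →L[ℝ] V →L[ℝ] ℝ} (hB : ∀ v w, B v w = B w v) :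
    (toEndo B).toLinearMap.IsSymmetric := by
  intro v w
  change inner ℝ (toEndo B v) w = inner ℝ v (toEndo B w)
  rw [inner_toEndo, real_inner_comm, inner_toEndo, hB]

/-- The eigenvalues of a symmetric form are values of the form on unit vectors. -/
theorem exists_eigenvalues_eq {n : ℕ} {B : V →L[ℝ] V →L[ℝ] ℝ} (hB : ∀ v w, B v w = B w v)
    (hn : Module.finrank ℝ V = n) (i : Fin n) :
    ∃ v : V, ‖v‖ = 1 ∧ B v v = (isSymmetric_toEndo hB).eigenvalues hn i := by
  refine ⟨(isSymmetric_toEndo hB).eigenvectorBasis hn i, OrthonormalBasis.norm_eq_one _ i, ?_⟩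
  rw [← inner_toEndo]
  have h := (isSymmetric_toEndo hB).apply_eigenvectorBasis hn i
  rw [ContinuousLinearMap.coe_coe] at h
  rw [h, real_inner_smul_left, real_inner_self_eq_norm_sq, OrthonormalBasis.norm_eq_one]
  simp

theorem pow_le_det_toEndo {n : ℕ} {B : V →L[ℝ] V →L[ℝ] ℝ} (hB : ∀ v w, B v w = B w v)
    (hn : Module.finrank ℝ V = n) {c : ℝ} (hc : 0 ≤ c) (h : ∀ v, c * ‖v‖ ^ 2 ≤ B v v) :
    c ^ n ≤ (toEndo B).det := by
  have := (isSymmetric_toEndo hB).det_eq_prod_eigenvalues hn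
  rw [ContinuousLinearMap.det, this]
  calc c ^ n = ∏ _i : Fin n, c := by simp
    _ ≤ _ := by
      refine Finset.prod_le_prod (fun _ _ ↦ hc) fun i _ ↦ ?_
      obtain ⟨v, hv, hvi⟩ := exists_eigenvalues_eq hB hn i
      simpa [hv, hvi] using h v

/-- Nonnegativity is essential: without it, an even number of very negative eigenvalues could make
the product large. -/
theorem det_toEndo_le_pow {n : ℕ} {B : V →L[ℝ] V →L[ℝ] ℝ} (hB : ∀ v w, B v w = B w v)
    (hn : Module.finrank ℝ V = n) {c : ℝ} (h0 : ∀ v, 0 ≤ B v v)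
    (h : ∀ v, B v v ≤ c * ‖v‖ ^ 2) : (toEndo B).det ≤ c ^ n := by
  have := (isSymmetric_toEndo hB).det_eq_prod_eigenvalues hn
  rw [ContinuousLinearMap.det, this]
  calc _ ≤ ∏ _i : Fin n, c := by
        refine Finset.prod_le_prod (fun i _ ↦ ?_) fun i _ ↦ ?_ <;>
          obtain ⟨v, hv, hvi⟩ := exists_eigenvalues_eq hB hn i
        · simpa [hvi] using h0 v
        · simpa [hv, hvi] using h v
    _ = _ := by simp

/-- A symmetric form is bounded above by any bound for its eigenvalues. -/
theorem apply_self_le_of_hasEigenvalue_le {B : V →L[ℝ] V →L[ℝ] ℝ} (hB : ∀ v w, B v w = B w v)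
    {c : ℝ} (h : ∀ l, Module.End.HasEigenvalue (toEndo B).toLinearMap l → l ≤ c) (v : V) :
    B v v ≤ c * ‖v‖ ^ 2 := by
  have hT := isSymmetric_toEndo hB
  set b := hT.eigenvectorBasis rfl with hb
  have hi (i) : inner ℝ (toEndo B v) (b i) = hT.eigenvalues rfl i * inner ℝ v (b i) := by
    have h1 := hT v (b i)
    have h2 := hT.apply_eigenvectorBasis rfl i
    rw [← hb] at h2
    rw [h2] at h1
    rw [ContinuousLinearMap.coe_coe] at h1
    rw [h1, real_inner_smul_right]
    simp
  rw [← inner_toEndo, ← real_inner_self_eq_norm_sq, ← b.sum_inner_mul_inner,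
    ← b.sum_inner_mul_inner, Finset.mul_sum]
  refine Finset.sum_le_sum fun i _ ↦ ?_
  rw [hi, real_inner_comm v (b i), mul_assoc]
  exact mul_le_mul_of_nonneg_right (h _ (hT.hasEigenvalue_eigenvalues rfl i))
    (mul_self_nonneg _)

theorem apply_ne_zero_of_det_ne_zero {B : V →L[ℝ] V →L[ℝ] ℝ} (h : (toEndo B).det ≠ 0) {v : V}
    (hv : v ≠ 0) : B v ≠ 0 := by
  intro h0
  have h1 : toEndo B v = 0 := by
    refine ext_inner_right ℝ fun w ↦ ?_
    rw [inner_toEndo, h0]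
    simp
  have h2 : LinearMap.ker (toEndo B).toLinearMap = ⊥ := by
    have : IsUnit (LinearMap.det (toEndo B).toLinearMap) := isUnit_iff_ne_zero.2 h
    exact (LinearMap.isUnit_iff_ker_eq_bot _).1 ((LinearMap.isUnit_iff_isUnit_det _).2 this)
  exact hv ((LinearMap.ker_eq_bot'.1 h2) v h1)

/-- A nonnegative symmetric form vanishes at the null vectors of its quadratic form. -/
theorem apply_eq_zero_of_apply_self_eq_zero {V : Type*} [AddCommGroup V] [Module ℝ V]
    [TopologicalSpace V] {B : V →L[ℝ] V →L[ℝ] ℝ} (hB : ∀ v w, B v w = B w v)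
    (h0 : ∀ v, 0 ≤ B v v) {v : V} (hv : B v v = 0) : B v = 0 := by
  ext w
  have key (t : ℝ) : 0 ≤ 2 * t * B v w + t * t * B w w := by
    have h1 := h0 (v + t • w)
    simp only [map_add, map_smul, add_apply, FunLike.coe_smul,
      Pi.smul_apply, smul_eq_mul, hv, hB w v] at h1
    linarith
  have hw := h0 w
  change B v w = 0
  by_contra hne
  have h1 := key (-(B v w) / (B w w + 1))
  have h2 : 0 < B w w + 1 := by linarith
  have h3 : 2 * (-(B v w) / (B w w + 1)) * B v w
      + -(B v w) / (B w w + 1) * (-(B v w) / (B w w + 1)) * B w w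
      = -(B v w) ^ 2 * (B w w + 2) / (B w w + 1) ^ 2 := by
    field_simp
    ring
  rw [h3] at h1
  have h4 : 0 < (B v w) ^ 2 := by positivity
  have h5 : -(B v w) ^ 2 * (B w w + 2) / (B w w + 1) ^ 2 < 0 :=
    div_neg_of_neg_of_pos (by nlinarith) (by positivity)
  linarith

end Forms

/-! ### Calculus in a normed space: extrema and the Hessian in coordinates. -/

section Euclidean

variable {E : Type*} [NormedAddCommGroup E] [NormedSpace ℝ E]

/-- On the compact unit sphere the form has a positive lower bound `c`, and a perturbation of
operator norm below `c` moves its values there by less than `c`. -/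
theorem eventually_posDef [FiniteDimensional ℝ E] {B₀ : E →L[ℝ] E →L[ℝ] ℝ}
    (h : ∀ v, v ≠ 0 → 0 < B₀ v v) :
    ∀ᶠ B : E →L[ℝ] E →L[ℝ] ℝ in 𝓝 B₀, ∀ v, v ≠ 0 → 0 < B v v := by
  have : ProperSpace E := FiniteDimensional.proper ℝ E
  obtain ⟨c, hc, hc'⟩ : ∃ c > 0, ∀ v : E, ‖v‖ = 1 → c ≤ B₀ v v := by
    rcases (Metric.sphere (0 : E) 1).eq_empty_or_nonempty with he | hne
    · refine ⟨1, one_pos, fun v hv ↦ ?_⟩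
      have : v ∈ Metric.sphere (0 : E) 1 := by simpa using hv
      simp [he] at this
    · obtain ⟨v, hv, hv'⟩ := (isCompact_sphere (0 : E) 1).exists_isMinOn hne
        (f := fun v ↦ B₀ v v) (by fun_prop)
      have hv1 : ‖v‖ = 1 := by simpa using hv
      refine ⟨B₀ v v, h v (by rw [← norm_pos_iff, hv1]; exact one_pos), fun w hw ↦ hv' ?_⟩
      simpa using hw
  filter_upwards [Metric.ball_mem_nhds B₀ hc] with B hB v hv
  have hn : 0 < ‖v‖ := norm_pos_iff.2 hv
  have h1 : ∀ w : E, ‖w‖ = 1 → 0 < B w w := by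
    intro w hw
    have h2 : ‖(B₀ - B) w w‖ ≤ ‖B₀ - B‖ * ‖w‖ * ‖w‖ := (B₀ - B).le_opNorm₂ w w
    have h3 : ‖B₀ - B‖ < c := (dist_eq_norm' B B₀).symm.trans_lt (Metric.mem_ball.1 hB)
    have h4 : (B₀ - B) w w = B₀ w w - B w w := rfl
    rw [hw, mul_one, mul_one, h4, Real.norm_eq_abs] at h2
    linarith [hc' w hw, le_abs_self (B₀ w w - B w w)]
  have h5 := h1 (‖v‖⁻¹ • v) (by rw [norm_smul, norm_inv, norm_norm, inv_mul_cancel₀ hn.ne'])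
  simp only [map_smul, FunLike.coe_smul, Pi.smul_apply, smul_eq_mul] at h5
  have h6 : 0 < ‖v‖⁻¹ := by positivity
  exact pos_of_mul_pos_right (pos_of_mul_pos_right h5 h6.le) h6.le

/-- Restrict to a line. A negative second derivative would make the minimum a local maximum too, so
the restriction would be locally constant and its second derivative zero. -/
theorem fderiv_fderiv_nonneg_of_isLocalMin {f : E → ℝ} {y : E} (hf : ContDiffAt ℝ 2 f y)
    (hmin : IsLocalMin f y) (v : E) : 0 ≤ fderiv ℝ (fderiv ℝ f) y v v := by
  by_contra! hneg
  have hline : ∀ t : ℝ, HasDerivAt (fun t : ℝ ↦ y + t • v) v t := fun t ↦ by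
    simpa using ((hasDerivAt_id t).smul_const v).const_add y
  have hcont : Tendsto (fun t : ℝ ↦ y + t • v) (𝓝 0) (𝓝 y) := by
    simpa using (hline 0).continuousAt.tendsto
  set k : ℝ → ℝ := fun t ↦ f (y + t • v) with hk
  have hd : ∀ᶠ t in 𝓝 (0 : ℝ), HasDerivAt k (fderiv ℝ f (y + t • v) v) t := by
    have : ∀ᶠ z in 𝓝 y, DifferentiableAt ℝ f z :=
      (hf.eventually (by simp)).mono fun z hz ↦ hz.differentiableAt (by simp)
    filter_upwards [hcont.eventually this] with t ht
    exact ht.hasFDerivAt.comp_hasDerivAt t (hline t)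
  have hdk : deriv k =ᶠ[𝓝 0] fun t ↦ fderiv ℝ f (y + t • v) v := hd.mono fun t ht ↦ ht.deriv
  have hD : DifferentiableAt ℝ (fderiv ℝ f) y :=
    (hf.fderiv_right (m := 1) (by norm_num)).differentiableAt (by simp)
  have hdd : deriv (deriv k) 0 = fderiv ℝ (fderiv ℝ f) y v v := by
    rw [hdk.deriv_eq]
    have h1 : HasFDerivAt (fderiv ℝ f) (fderiv ℝ (fderiv ℝ f) y) (y + (0 : ℝ) • v) := by
      simpa using hD.hasFDerivAt
    have h2 : HasDerivAt (fun t : ℝ ↦ fderiv ℝ f (y + t • v))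
      (fderiv ℝ (fderiv ℝ f) y v) 0 := h1.comp_hasDerivAt (0 : ℝ) (hline 0)
    exact (h2.clm_apply (hasDerivAt_const 0 v)).deriv.trans (by simp)
  have hkmin : IsLocalMin k 0 := by
    have := hcont.eventually hmin
    filter_upwards [this] with t ht
    simpa [hk] using ht
  have hkmax : IsLocalMax k 0 := isLocalMax_of_deriv_deriv_neg (hdd ▸ hneg) hkmin.deriv_eq_zero
    hd.self_of_nhds.continuousAt
  have hconst : k =ᶠ[𝓝 0] fun _ ↦ k 0 := by
    filter_upwards [hkmin, hkmax] with t h1 h2 using le_antisymm h2 h1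
  have hz : deriv k =ᶠ[𝓝 0] fun _ ↦ 0 := by
    filter_upwards [hconst.eventuallyEq_nhds] with t ht
    rw [ht.deriv_eq]
    simp
  rw [hz.deriv_eq] at hdd
  simp at hdd
  linarith

theorem fderiv_fderiv_nonpos_of_isLocalMax {f : E → ℝ} {y : E} (hf : ContDiffAt ℝ 2 f y)
    (hmax : IsLocalMax f y) (v : E) : fderiv ℝ (fderiv ℝ f) y v v ≤ 0 := by
  have h := fderiv_fderiv_nonneg_of_isLocalMin hf.neg hmax.neg v
  have h1 : fderiv ℝ (-f) = -fderiv ℝ f := funext fun z ↦ fderiv_neg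
  change 0 ≤ fderiv ℝ (fderiv ℝ (-f)) y v v at h
  rw [h1, fderiv_neg] at h
  simpa using h

/-- The second covariant derivative of `f` at `y` in a chart with metric `B`, where `Z` stands for
the gradient of `f`. -/
noncomputable def coordHessian (f : E → ℝ) (B : E → E →L[ℝ] E →L[ℝ] ℝ) (y Z v w : E) : ℝ :=
  fderiv ℝ (fderiv ℝ f) y v w
    - (1 / 2) * (fderiv ℝ B y v Z w + fderiv ℝ B y w Z v - fderiv ℝ B y Z v w)

/-- With `w` frozen, `(df w)² / B w w` is a lower bound for the squared gradient norm, by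
Cauchy–Schwarz, with equality at `t = 0` if `w` is the gradient there. It replaces that norm in the
first order condition, so the gradient need not be differentiated. -/
theorem hasDerivAt_exp_mul_lowerGradient {f : E → ℝ} {B : E → E →L[ℝ] E →L[ℝ] ℝ} {y w : E}
    (hf : ContDiffAt ℝ 2 f y) (hB : DifferentiableAt ℝ B y) {q : ℝ} (hq : q ≠ 0)
    (hBw : B y w w = q) (hfw : fderiv ℝ f y w = q) (c : ℝ) :
    HasDerivAt (fun t : ℝ ↦ Real.exp (f (y + t • w)) *
        ((fderiv ℝ f (y + t • w) w) ^ 2 / B (y + t • w) w w + c))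
      (Real.exp (f y) * (q * (q + c) + 2 * coordHessian f B y w w w)) 0 := by
  have hline : HasDerivAt (fun t : ℝ ↦ y + t • w) w 0 := by
    simpa using ((hasDerivAt_id (0 : ℝ)).smul_const w).const_add y
  have hf' : DifferentiableAt ℝ f y := hf.differentiableAt (by simp)
  have hD : DifferentiableAt ℝ (fderiv ℝ f) y :=
    (hf.fderiv_right (m := 1) (by norm_num)).differentiableAt (by simp)
  have e0 : y + (0 : ℝ) • w = y := by simp
  have h1 : HasDerivAt (fun t : ℝ ↦ f (y + t • w)) (fderiv ℝ f y w) 0 :=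
    HasFDerivAt.comp_hasDerivAt (0 : ℝ) (by rw [e0]; exact hf'.hasFDerivAt) hline
  have h2 : HasDerivAt (fun t : ℝ ↦ fderiv ℝ f (y + t • w))
      (fderiv ℝ (fderiv ℝ f) y w) 0 :=
    HasFDerivAt.comp_hasDerivAt (0 : ℝ) (by rw [e0]; exact hD.hasFDerivAt) hline
  have h3 : HasDerivAt (fun t : ℝ ↦ B (y + t • w)) (fderiv ℝ B y w) 0 :=
    HasFDerivAt.comp_hasDerivAt (E := E →L[ℝ] E →L[ℝ] ℝ) (l := B) (0 : ℝ)
      (by rw [e0]; exact hB.hasFDerivAt) hline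
  have h2' := h2.clm_apply (hasDerivAt_const 0 w)
  have h3' := (h3.clm_apply (hasDerivAt_const 0 w)).clm_apply (hasDerivAt_const 0 w)
  have h4 := h1.exp.mul (((h2'.pow 2).div h3' (by rw [e0, hBw]; exact hq)).add_const c)
  refine h4.congr_deriv ?_
  simp only [e0, hBw, hfw, map_zero, add_zero, coordHessian]
  simp [hBw, hfw]
  field_simp

theorem fderiv_apply_apply {B : E → E →L[ℝ] E →L[ℝ] ℝ} {y : E} (hB : DifferentiableAt ℝ B y) (a b c : E) :
    fderiv ℝ B y a b c = fderiv ℝ (fun z ↦ B z b c) y a := by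
  have := (hB.hasFDerivAt.clm_apply (hasFDerivAt_const b y)).clm_apply (hasFDerivAt_const c y)
  rw [this.fderiv]
  simp

/-- The second covariant derivative does not depend on the chart. -/
theorem coordHessian_comp {f f₀ : E → ℝ} {B B₀ : E → E →L[ℝ] E →L[ℝ] ℝ} {τ : E → E} {y : E}
    (hτ : ContDiffAt ℝ 2 τ y) (hf : ContDiffAt ℝ 2 f (τ y)) (hB : DifferentiableAt ℝ B (τ y))
    (hf₀ : f₀ =ᶠ[𝓝 y] f ∘ τ)
    (hB₀ : ∀ᶠ z in 𝓝 y, B₀ z = (B (τ z)).bilinearComp (fderiv ℝ τ z) (fderiv ℝ τ z))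
    (hB₀d : DifferentiableAt ℝ B₀ y)
    (hsymm : ∀ v w, B (τ y) v w = B (τ y) w v) {Z : E}
    (hZ : ∀ v, B (τ y) (fderiv ℝ τ y Z) v = fderiv ℝ f (τ y) v) (v w : E) :
    coordHessian f₀ B₀ y Z v w =
      coordHessian f B (τ y) (fderiv ℝ τ y Z) (fderiv ℝ τ y v) (fderiv ℝ τ y w) := by
  have hτ' : DifferentiableAt ℝ τ y := hτ.differentiableAt (by simp)
  have hDτ : DifferentiableAt ℝ (fderiv ℝ τ) y :=
    (hτ.fderiv_right (m := 1) (by norm_num)).differentiableAt (by simp)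
  have hDf : DifferentiableAt ℝ (fderiv ℝ f) (τ y) :=
    (hf.fderiv_right (m := 1) (by norm_num)).differentiableAt (by simp)
  have hsτ : ∀ a b, fderiv ℝ (fderiv ℝ τ) y a b = fderiv ℝ (fderiv ℝ τ) y b a := fun a b ↦
    hτ.isSymmSndFDerivAt (by simp) a b
  set T := fderiv ℝ τ y with hT
  set D2 := fderiv ℝ (fderiv ℝ τ) y with hD2
  have hfirst : fderiv ℝ f₀ =ᶠ[𝓝 y] fun z ↦ (fderiv ℝ f (τ z)).comp (fderiv ℝ τ z) := by
    have h1 : ∀ᶠ z in 𝓝 y, DifferentiableAt ℝ τ z :=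
      (hτ.eventually (by simp)).mono fun z hz ↦ hz.differentiableAt (by simp)
    have h2 : ∀ᶠ z in 𝓝 y, DifferentiableAt ℝ f (τ z) :=
      hτ'.continuousAt.eventually
        ((hf.eventually (by simp)).mono fun z hz ↦ hz.differentiableAt (by simp))
    filter_upwards [h1, h2, hf₀.eventuallyEq_nhds] with z h1 h2 h3
    rw [h3.fderiv_eq]
    exact fderiv_comp z h2 h1
  have hsecond (a b : E) : fderiv ℝ (fderiv ℝ f₀) y a b =
      fderiv ℝ (fderiv ℝ f) (τ y) (T a) (T b) + fderiv ℝ f (τ y) (D2 a b) := by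
    rw [hfirst.fderiv_eq]
    have h1 : HasFDerivAt (fun z ↦ fderiv ℝ f (τ z)) _ y :=
      hDf.hasFDerivAt.comp y hτ'.hasFDerivAt
    rw [(h1.clm_comp hDτ.hasFDerivAt).fderiv]
    simp [← hT, ← hD2, add_comm]
  have hmetric (a b c : E) : fderiv ℝ B₀ y a b c =
      fderiv ℝ B (τ y) (T a) (T b) (T c) + B (τ y) (D2 a b) (T c) + B (τ y) (T b) (D2 a c) := by
    have h1 : (fun z ↦ B₀ z b c) =ᶠ[𝓝 y] fun z ↦ B (τ z) (fderiv ℝ τ z b) (fderiv ℝ τ z c) := by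
      filter_upwards [hB₀] with z hz
      rw [hz]
      rfl
    have h2 : HasFDerivAt (fun z ↦ B (τ z)) ((fderiv ℝ B (τ y)).comp T) y :=
      HasFDerivAt.comp (G := E →L[ℝ] E →L[ℝ] ℝ) (g := B) y hB.hasFDerivAt hτ'.hasFDerivAt
    have h3 (b : E) : HasFDerivAt (fun z ↦ fderiv ℝ τ z b) _ y :=
      hDτ.hasFDerivAt.clm_apply (hasFDerivAt_const b y)
    rw [fderiv_apply_apply hB₀d, h1.fderiv_eq, ((h2.clm_apply (h3 b)).clm_apply (h3 c)).fderiv]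
    simp [← hT, ← hD2]
    ring
  simp only [coordHessian, hsecond, hmetric]
  -- The terms with second derivatives of `τ` cancel: those left by the Christoffel symbol pair with
  -- `T Z`, and `hZ` turns them into the term from the chain rule for `f`.
  rw [hsτ w v, hsτ Z v, hsτ Z w, hZ, hsymm (T v) (D2 w Z)]
  ring

end Euclidean

theorem two_le_infty : (2 : WithTop ℕ∞) ≤ ∞ :=
  WithTop.coe_le_coe.2 (le_top : (2 : ℕ∞) ≤ ⊤)

/-! ### Coordinate frames, and the metric and Hessian in an arbitrary chart. -/

section Chart

variable {n : ℕ} {N : Type*} [TopologicalSpace N] [ChartedSpace (EuclideanSpace ℝ (Fin n)) N]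

/-- The derivative of the inverse of the preferred chart at `x`, i.e. the map that sends the
coefficients of a tangent vector in the coordinate frame to the vector. -/
noncomputable def coordFrame (x : N) (y : EuclideanSpace ℝ (Fin n)) :
    EuclideanSpace ℝ (Fin n) →L[ℝ] TangentSpace (𝓡 n) ((extChartAt (𝓡 n) x).symm y) :=
  mfderiv (𝓡 n) (𝓡 n) (extChartAt (𝓡 n) x).symm y

theorem isOpen_chart_target (x : N) : IsOpen (extChartAt (𝓡 n) x).target :=
  isOpen_extChartAt_target x

theorem exists_chart_symm_eq (x : N) :
    ∃ y ∈ (extChartAt (𝓡 n) x).target, (extChartAt (𝓡 n) x).symm y = x :=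
  ⟨extChartAt (𝓡 n) x x, mem_extChartAt_target x, extChartAt_to_inv x⟩

section Manifold

variable [IsManifold (𝓡 n) ∞ N]

theorem contMDiffAt_chart_symm {x : N} {y : EuclideanSpace ℝ (Fin n)}
    (hy : y ∈ (extChartAt (𝓡 n) x).target) :
    ContMDiffAt (𝓡 n) (𝓡 n) ∞ (extChartAt (𝓡 n) x).symm y :=
  (contMDiffOn_extChartAt_symm x).contMDiffAt ((isOpen_chart_target x).mem_nhds hy)

theorem mdifferentiableAt_chart_symm {x : N} {y : EuclideanSpace ℝ (Fin n)}
    (hy : y ∈ (extChartAt (𝓡 n) x).target) :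
    MDifferentiableAt (𝓡 n) (𝓡 n) (extChartAt (𝓡 n) x).symm y :=
  (contMDiffAt_chart_symm hy).mdifferentiableAt (by simp)

theorem coordFrame_bijective {x : N} {y : EuclideanSpace ℝ (Fin n)}
    (hy : y ∈ (extChartAt (𝓡 n) x).target) : Function.Bijective (coordFrame x y) := by
  have h := isInvertible_mfderivWithin_extChartAt_symm (I := 𝓡 n) (x := x) hy
  have h1 : range (𝓡 n) = univ := (𝓡 n).range_eq_univ
  rw [h1, mfderivWithin_univ] at h
  exact h.bijective

theorem contMDiffOn_coordFrame (x : N) (v : EuclideanSpace ℝ (Fin n)) :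
    ContMDiffOn (𝓡 n) (𝓡 n).tangent ∞
      (fun y ↦ (⟨(extChartAt (𝓡 n) x).symm y, coordFrame x y v⟩ : TangentBundle (𝓡 n) N))
      (extChartAt (𝓡 n) x).target := by
  have ho := isOpen_chart_target (n := n) x
  have h1 := (contMDiffOn_extChartAt_symm (I := 𝓡 n) (n := ∞) x).contMDiffOn_tangentMapWithin
    (m := ∞) (by simp) ho.uniqueMDiffOn
  have h2 : ContMDiff (𝓡 n) (𝓡 n).tangent ∞
      (fun y : EuclideanSpace ℝ (Fin n) ↦
        (⟨y, v⟩ : TangentBundle (𝓡 n) (EuclideanSpace ℝ (Fin n)))) :=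
    contMDiff_vectorSpace_iff_contDiff.2 contDiff_const
  refine (h1.comp h2.contMDiffOn fun y hy ↦ hy).congr fun y hy ↦ ?_
  simp only [Function.comp_apply, tangentMapWithin]
  rw [mfderivWithin_of_isOpen ho hy]
  rfl

theorem differential_coordFrame {u : N → ℝ} (hu : ContMDiff (𝓡 n) 𝓘(ℝ, ℝ) 2 u) {x : N}
    {y : EuclideanSpace ℝ (Fin n)} (hy : y ∈ (extChartAt (𝓡 n) x).target)
    (v : EuclideanSpace ℝ (Fin n)) :
    differential n u ((extChartAt (𝓡 n) x).symm y) (coordFrame x y v) =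
      fderiv ℝ (u ∘ (extChartAt (𝓡 n) x).symm) y v := by
  have h := mfderiv_comp y (hu.mdifferentiableAt (by simp)) (mdifferentiableAt_chart_symm hy)
  rw [mfderiv_eq_fderiv] at h
  rw [h]
  rfl

theorem contDiffAt_comp_chart_symm {u : N → ℝ} (hu : ContMDiff (𝓡 n) 𝓘(ℝ, ℝ) 2 u) {x : N}
    {y : EuclideanSpace ℝ (Fin n)} (hy : y ∈ (extChartAt (𝓡 n) x).target) :
    ContDiffAt ℝ 2 (u ∘ (extChartAt (𝓡 n) x).symm) y :=
  ((hu _).comp y ((contMDiffAt_chart_symm hy).of_le two_le_infty)).contDiffAt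

/-- In the trivialization by the preferred chart at the point, the coordinate frame of any chart
is given by the derivative of the change of charts. -/
theorem coordFrame_eq_fderiv {x : N} {y : EuclideanSpace ℝ (Fin n)}
    (hy : y ∈ (extChartAt (𝓡 n) x).target) :
    (coordFrame x y : EuclideanSpace ℝ (Fin n) →L[ℝ] EuclideanSpace ℝ (Fin n)) =
      fderiv ℝ (extChartAt (𝓡 n) ((extChartAt (𝓡 n) x).symm y) ∘ (extChartAt (𝓡 n) x).symm) y := by
  refine (mdifferentiableAt_chart_symm hy).mfderiv.trans ?_
  simp only [writtenInExtChartAt, mfld_simps]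
  rw [fderivWithin_univ]
  rfl

variable [RiemannianBundle (fun x : N ↦ TangentSpace (𝓡 n) x)]

omit [IsManifold (𝓡 n) ∞ N] in
theorem chartMetric_apply (x : N) (y v w : EuclideanSpace ℝ (Fin n)) :
    chartMetric x y v w = inner ℝ (coordFrame x y v) (coordFrame x y w) := rfl

omit [IsManifold (𝓡 n) ∞ N] in
theorem chartMetric_symm (x : N) (y v w : EuclideanSpace ℝ (Fin n)) :
    chartMetric x y v w = chartMetric x y w v := by
  rw [chartMetric_apply, chartMetric_apply, real_inner_comm]

variable [IsContMDiffRiemannianBundle (𝓡 n) ∞ (EuclideanSpace ℝ (Fin n))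
      (fun x : N ↦ TangentSpace (𝓡 n) x)]

theorem contDiffOn_chartMetric (x : N) :
    ContDiffOn ℝ ∞ (chartMetric x) (extChartAt (𝓡 n) x).target := by
  refine contDiffOn_clm_apply.2 fun v ↦ contDiffOn_clm_apply.2 fun w ↦ ?_
  exact ((contMDiffOn_coordFrame x v).inner_bundle (contMDiffOn_coordFrame x w)).contDiffOn

theorem differentiableAt_chartMetric {x : N} {y : EuclideanSpace ℝ (Fin n)}
    (hy : y ∈ (extChartAt (𝓡 n) x).target) : DifferentiableAt ℝ (chartMetric x) y :=
  ((contDiffOn_chartMetric x).contDiffAt ((isOpen_chart_target x).mem_nhds hy)).differentiableAt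
    (by simp)

omit [IsManifold (𝓡 n) ∞ N] [IsContMDiffRiemannianBundle (𝓡 n) ∞ (EuclideanSpace ℝ (Fin n))
      (fun x : N ↦ TangentSpace (𝓡 n) x)] in
/-- The Hessian in the preferred chart at the point. -/
theorem hessian_apply (u : N → ℝ) (p : N) (a b : EuclideanSpace ℝ (Fin n)) :
    (hessian u p : EuclideanSpace ℝ (Fin n) →L[ℝ] EuclideanSpace ℝ (Fin n) →L[ℝ] ℝ) a b =
      coordHessian (u ∘ (extChartAt (𝓡 n) p).symm) (chartMetric p) (extChartAt (𝓡 n) p p)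
        (grad n u p) a b := by
  change fderiv ℝ (fderiv ℝ (u ∘ (extChartAt (𝓡 n) p).symm)) (extChartAt (𝓡 n) p p) a b
    - (christoffel p (grad n u p)) a b = _
  simp only [christoffel, coordHessian]
  rfl

omit [IsContMDiffRiemannianBundle (𝓡 n) ∞ (EuclideanSpace ℝ (Fin n))
      (fun x : N ↦ TangentSpace (𝓡 n) x)] in
theorem grad_coordFrame {u : N → ℝ} (hu : ContMDiff (𝓡 n) 𝓘(ℝ, ℝ) 2 u) {x : N}
    {y Z : EuclideanSpace ℝ (Fin n)} (hy : y ∈ (extChartAt (𝓡 n) x).target)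
    (hZ : coordFrame x y Z = grad n u ((extChartAt (𝓡 n) x).symm y))
    (v : EuclideanSpace ℝ (Fin n)) :
    chartMetric x y Z v = fderiv ℝ (u ∘ (extChartAt (𝓡 n) x).symm) y v := by
  rw [chartMetric_apply, hZ, ← differential_coordFrame hu hy]
  exact inner_sharp _ _

/-- The Hessian in the coordinate frame of any chart. -/
theorem hessian_coordFrame {u : N → ℝ} (hu : ContMDiff (𝓡 n) 𝓘(ℝ, ℝ) 2 u) {x : N}
    {y Z : EuclideanSpace ℝ (Fin n)} (hy : y ∈ (extChartAt (𝓡 n) x).target)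
    (hZ : coordFrame x y Z = grad n u ((extChartAt (𝓡 n) x).symm y))
    (v w : EuclideanSpace ℝ (Fin n)) :
    hessian u ((extChartAt (𝓡 n) x).symm y) (coordFrame x y v) (coordFrame x y w) =
      coordHessian (u ∘ (extChartAt (𝓡 n) x).symm) (chartMetric x) y Z v w := by
  set p := (extChartAt (𝓡 n) x).symm y with hp
  set τ : EuclideanSpace ℝ (Fin n) → EuclideanSpace ℝ (Fin n) :=
    extChartAt (𝓡 n) p ∘ (extChartAt (𝓡 n) x).symm with hτ
  set T := fderiv ℝ τ y with hT
  have hframe (v : EuclideanSpace ℝ (Fin n)) : coordFrame x y v = T v :=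
    congrArg (fun L : EuclideanSpace ℝ (Fin n) →L[ℝ] EuclideanSpace ℝ (Fin n) ↦ L v)
      (coordFrame_eq_fderiv hy)
  have hsurj : Function.Surjective T := fun a ↦ by
    obtain ⟨b, hb⟩ := (coordFrame_bijective hy).2 a
    exact ⟨b, (hframe b).symm.trans hb⟩
  have hτy : τ y = extChartAt (𝓡 n) p p := rfl
  have hτyt : τ y ∈ (extChartAt (𝓡 n) p).target := mem_extChartAt_target p
  have hev : ∀ᶠ z in 𝓝 y, z ∈ (extChartAt (𝓡 n) x).target ∧
      (extChartAt (𝓡 n) x).symm z ∈ (extChartAt (𝓡 n) p).source :=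
    (Filter.Eventually.and ((isOpen_chart_target x).mem_nhds hy)
      ((contMDiffAt_chart_symm hy).continuousAt.eventually (extChartAt_source_mem_nhds p)))
  have hτd : ∀ᶠ z in 𝓝 y, ContDiffAt ℝ 2 τ z := by
    filter_upwards [hev] with z hz
    refine ContDiffAt.of_le (n := ∞) ?_ two_le_infty
    refine ContMDiffAt.contDiffAt ?_
    refine ContMDiffAt.comp z (contMDiffAt_extChartAt' ?_) (contMDiffAt_chart_symm hz.1)
    simpa using hz.2
  have hback : ∀ᶠ z in 𝓝 y, (extChartAt (𝓡 n) p).symm (τ z) = (extChartAt (𝓡 n) x).symm z :=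
    hev.mono fun z hz ↦ (extChartAt (𝓡 n) p).left_inv hz.2
  have hB₀ : ∀ᶠ z in 𝓝 y, chartMetric x z =
      (chartMetric p (τ z)).bilinearComp (fderiv ℝ τ z) (fderiv ℝ τ z) := by
    filter_upwards [hev, hτd, hback.eventually_nhds] with z hz hzd hzb
    have hzt : τ z ∈ (extChartAt (𝓡 n) p).target := (extChartAt (𝓡 n) p).map_source hz.2
    have h1 : (mfderiv (𝓡 n) (𝓡 n) (extChartAt (𝓡 n) x).symm z :
        EuclideanSpace ℝ (Fin n) →L[ℝ] EuclideanSpace ℝ (Fin n)) =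
        (mfderiv (𝓡 n) (𝓡 n) (extChartAt (𝓡 n) p).symm (τ z) :
        EuclideanSpace ℝ (Fin n) →L[ℝ] EuclideanSpace ℝ (Fin n)).comp (fderiv ℝ τ z) := by
      have h2 : (extChartAt (𝓡 n) x).symm =ᶠ[𝓝 z] (extChartAt (𝓡 n) p).symm ∘ τ :=
        hzb.mono fun a ha ↦ ha.symm
      refine (h2.mfderiv_eq (I := 𝓡 n) (I' := 𝓡 n)).trans ?_
      have h3 := mfderiv_comp z (mdifferentiableAt_chart_symm hzt)
        (hzd.differentiableAt (by simp)).mdifferentiableAt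
      rw [mfderiv_eq_fderiv] at h3
      exact h3
    -- With values in forms on the fixed model space, the base point can be rewritten without
    -- transporting tangent vectors.
    let G : N → EuclideanSpace ℝ (Fin n) →L[ℝ] EuclideanSpace ℝ (Fin n) →L[ℝ] ℝ :=
      fun q ↦ metricTensor q
    ext a b
    change G ((extChartAt (𝓡 n) x).symm z)
      ((mfderiv (𝓡 n) (𝓡 n) (extChartAt (𝓡 n) x).symm z :
        EuclideanSpace ℝ (Fin n) →L[ℝ] EuclideanSpace ℝ (Fin n)) a)
      ((mfderiv (𝓡 n) (𝓡 n) (extChartAt (𝓡 n) x).symm z :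
        EuclideanSpace ℝ (Fin n) →L[ℝ] EuclideanSpace ℝ (Fin n)) b) =
      G ((extChartAt (𝓡 n) p).symm (τ z)) _ _
    rw [h1, hzb.self_of_nhds]
    rfl
  have hf₀ : u ∘ (extChartAt (𝓡 n) x).symm =ᶠ[𝓝 y] (u ∘ (extChartAt (𝓡 n) p).symm) ∘ τ :=
    hback.mono fun z hz ↦ congrArg u hz.symm
  have hτ' : DifferentiableAt ℝ τ y := hτd.self_of_nhds.differentiableAt (by simp)
  have hf := contDiffAt_comp_chart_symm hu hτyt
  -- The gradient identity in the chart at `x` gives this on the range of `T`, which is everything.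
  have hTZ (a : EuclideanSpace ℝ (Fin n)) :
      chartMetric p (τ y) (T Z) a = fderiv ℝ (u ∘ (extChartAt (𝓡 n) p).symm) (τ y) a := by
    obtain ⟨b, rfl⟩ := hsurj a
    have h1 := grad_coordFrame hu hy hZ b
    rw [hB₀.self_of_nhds, hf₀.fderiv_eq, fderiv_comp y (hf.differentiableAt (by simp)) hτ'] at h1
    exact h1
  rw [coordHessian_comp hτd.self_of_nhds hf (differentiableAt_chartMetric hτyt) hf₀ hB₀
    (differentiableAt_chartMetric hy) (chartMetric_symm p (τ y)) hTZ]
  have h5 := hessian_apply u p (T v) (T w)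
  rw [← hτy] at h5
  have h6 : T Z = grad n u p := (hframe Z).symm.trans hZ
  rw [← h6] at h5
  rw [← h5, hframe v, hframe w]

end Manifold

end Chart

theorem continuousOn_fderiv_apply {E G : Type*} [NormedAddCommGroup E] [NormedSpace ℝ E]
    [NormedAddCommGroup G] [NormedSpace ℝ G] {f : E → G} {a : E → E} {s : Set E}
    (hf : ContDiffOn ℝ 1 f s) (hs : IsOpen s) (ha : ContinuousOn a s) :
    ContinuousOn (fun y ↦ fderiv ℝ f y (a y)) s :=
  (hf.continuousOn_fderiv_of_isOpen hs le_rfl).clm_apply ha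

/-! ### Continuity of tensor fields, read off from coordinate coefficients. -/

section Continuity

variable {n : ℕ} {N : Type*} [TopologicalSpace N] [ChartedSpace (EuclideanSpace ℝ (Fin n)) N]

/-- The tensor is positive definite at the point `q`. -/
def IsPosDefAt (T : TwoTensor n N) (q : N) : Prop :=
  ∀ v : TangentSpace (𝓡 n) q, v ≠ 0 → 0 < T q v v

/-- The coefficients of the tensor in the coordinate frame of any chart are continuous. -/
def HasContinuousCoeffs (T : TwoTensor n N) : Prop :=
  ∀ (x : N) (v w : EuclideanSpace ℝ (Fin n)),
    ContinuousOn (fun y ↦ T ((extChartAt (𝓡 n) x).symm y) (coordFrame x y v) (coordFrame x y w))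
      (extChartAt (𝓡 n) x).target

theorem eventually_of_eventually_chart {x : N} {y : EuclideanSpace ℝ (Fin n)}
    (hy : y ∈ (extChartAt (𝓡 n) x).target) {P : N → Prop}
    (h : ∀ᶠ z in 𝓝 y, P ((extChartAt (𝓡 n) x).symm z)) :
    ∀ᶠ q in 𝓝 ((extChartAt (𝓡 n) x).symm y), P q := by
  have hs := (extChartAt (𝓡 n) x).map_target hy
  have hc : Tendsto (extChartAt (𝓡 n) x) (𝓝 ((extChartAt (𝓡 n) x).symm y)) (𝓝 y) := by
    have := (continuousAt_extChartAt' hs).tendsto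
    rwa [(extChartAt (𝓡 n) x).right_inv hy] at this
  filter_upwards [hc.eventually h, (isOpen_extChartAt_source x).mem_nhds hs] with q hq hqs
  rwa [(extChartAt (𝓡 n) x).left_inv hqs] at hq

theorem continuous_of_continuousOn_chart {g : N → ℝ}
    (h : ∀ x : N, ContinuousOn (g ∘ (extChartAt (𝓡 n) x).symm) (extChartAt (𝓡 n) x).target) :
    Continuous g := by
  refine continuous_iff_continuousAt.2 fun x ↦ ?_
  have h1 := (h x).continuousAt ((isOpen_chart_target x).mem_nhds (mem_extChartAt_target x))
  have h2 := h1.comp (continuousAt_extChartAt x)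
  refine h2.congr ?_
  filter_upwards [extChartAt_source_mem_nhds (I := 𝓡 n) x] with q hq
  simp only [Function.comp_apply]
  rw [(extChartAt (𝓡 n) x).left_inv hq]

namespace HasContinuousCoeffs

variable {T T' : TwoTensor n N}

theorem add (h : HasContinuousCoeffs T) (h' : HasContinuousCoeffs T') :
    HasContinuousCoeffs (fun x ↦ T x + T' x) := fun x v w ↦ (h x v w).add (h' x v w)

theorem sub (h : HasContinuousCoeffs T) (h' : HasContinuousCoeffs T') :
    HasContinuousCoeffs (fun x ↦ T x - T' x) := fun x v w ↦ (h x v w).sub (h' x v w)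

variable [IsManifold (𝓡 n) ∞ N]

theorem smul {c : N → ℝ} (hc : Continuous c) (h : HasContinuousCoeffs T) :
    HasContinuousCoeffs (fun x ↦ c x • T x) := fun x v w ↦
  (hc.comp_continuousOn fun _ hy ↦ (contMDiffAt_chart_symm hy).continuousAt.continuousWithinAt).mul
    (h x v w)

/-- The coordinate frame carries the tensor to a continuous family of forms on the model space,
where `eventually_posDef` applies; bijectivity of the frame carries the conclusion back. -/
theorem isOpen_isPosDefAt (h : HasContinuousCoeffs T) : IsOpen {q | IsPosDefAt T q} := by
  refine isOpen_iff_mem_nhds.2 fun q hq ↦ ?_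
  obtain ⟨y, hy, hyq⟩ := exists_chart_symm_eq (n := n) q
  rw [← hyq] at hq
  suffices H : ∀ᶠ q' in 𝓝 ((extChartAt (𝓡 n) q).symm y), IsPosDefAt T q' by
    rwa [hyq] at H
  refine eventually_of_eventually_chart hy ?_
  set B : EuclideanSpace ℝ (Fin n) → EuclideanSpace ℝ (Fin n) →L[ℝ] EuclideanSpace ℝ (Fin n)
      →L[ℝ] ℝ := fun z ↦
    let L : EuclideanSpace ℝ (Fin n) →L[ℝ] EuclideanSpace ℝ (Fin n) := coordFrame q z
    let A : EuclideanSpace ℝ (Fin n) →L[ℝ] EuclideanSpace ℝ (Fin n) →L[ℝ] ℝ :=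
      T ((extChartAt (𝓡 n) q).symm z)
    A.bilinearComp L L with hB
  have hBc : ContinuousOn B (extChartAt (𝓡 n) q).target :=
    continuousOn_clm_apply.2 fun v ↦ continuousOn_clm_apply.2 fun w ↦ h q v w
  have hinj (z) (hz : z ∈ (extChartAt (𝓡 n) q).target) (v) (hv : v ≠ 0) :
      coordFrame q z v ≠ 0 := fun h0 ↦
    hv ((coordFrame_bijective hz).1 (h0.trans (map_zero _).symm))
  have hpos : ∀ v, v ≠ 0 → 0 < B y v v := fun v hv ↦ hq _ (hinj y hy v hv)
  have hev := (hBc.continuousAt ((isOpen_chart_target q).mem_nhds hy)).eventually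
    (eventually_posDef hpos)
  filter_upwards [hev, (isOpen_chart_target q).mem_nhds hy] with z hz hzt v hv
  obtain ⟨a, rfl⟩ := (coordFrame_bijective hzt).2 v
  refine hz a fun h0 ↦ hv ?_
  rw [h0, map_zero]

/-- A negative value on one vector persists nearby for the vector with the same coefficients. -/
theorem isClosed_nonneg (h : HasContinuousCoeffs T) :
    IsClosed {q | ∀ v : TangentSpace (𝓡 n) q, 0 ≤ T q v v} := by
  refine ⟨isOpen_iff_mem_nhds.2 fun q hq ↦ ?_⟩
  obtain ⟨y, hy, hyq⟩ := exists_chart_symm_eq (n := n) q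
  rw [← hyq] at hq
  suffices H : ∀ᶠ q' in 𝓝 ((extChartAt (𝓡 n) q).symm y),
      q' ∈ {q | ∀ v : TangentSpace (𝓡 n) q, 0 ≤ T q v v}ᶜ by
    rwa [hyq] at H
  refine eventually_of_eventually_chart hy ?_
  obtain ⟨v, hv⟩ := not_forall.1 hq
  obtain ⟨a, rfl⟩ := (coordFrame_bijective hy).2 v
  have hc := (h q a a).continuousAt ((isOpen_chart_target q).mem_nhds hy)
  filter_upwards [hc.eventually_lt continuousAt_const (not_le.1 hv)] with z hz hz'
  exact absurd (hz' (coordFrame q z a)) (not_le.2 hz)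

end HasContinuousCoeffs

section Riemannian

variable [IsManifold (𝓡 n) ∞ N]

theorem IsContinuousTensor.hasContinuousCoeffs {S : TwoTensor n N} (hS : IsContinuousTensor S) :
    HasContinuousCoeffs S := by
  intro x v w y hy
  refine ContinuousAt.continuousWithinAt ?_
  have hfr (v : EuclideanSpace ℝ (Fin n)) : ContinuousAt (fun y ↦
      (⟨(extChartAt (𝓡 n) x).symm y, coordFrame x y v⟩ : TangentBundle (𝓡 n) N)) y :=
    (contMDiffOn_coordFrame x v).continuousOn.continuousAt ((isOpen_chart_target x).mem_nhds hy)
  have hb := (contMDiffAt_chart_symm hy).continuousAt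
  have hSc := ContinuousAt.comp (x := y) (f := (extChartAt (𝓡 n) x).symm)
    (Continuous.continuousAt hS) hb
  have key : ContinuousAt
      (fun m ↦ TotalSpace.mk' ℝ (E := Bundle.Trivial N ℝ) ((extChartAt (𝓡 n) x).symm m)
        (S ((extChartAt (𝓡 n) x).symm m) (coordFrame x m v) (coordFrame x m w))) y :=
    ContinuousAt.clm_bundle_apply₂ (F₁ := EuclideanSpace ℝ (Fin n))
      (F₂ := EuclideanSpace ℝ (Fin n)) hSc (hfr v) (hfr w)
  simp only [FiberBundle.continuousAt_totalSpace] at key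
  exact key.2

theorem hasContinuousCoeffs_differential {u : N → ℝ} (hu : ContMDiff (𝓡 n) 𝓘(ℝ, ℝ) 2 u) :
    HasContinuousCoeffs fun x : N ↦ (differential n u x).smulRight (differential n u x) := by
  intro x v w
  have hf : ContinuousOn (fderiv ℝ (u ∘ (extChartAt (𝓡 n) x).symm)) (extChartAt (𝓡 n) x).target :=
    fun y hy ↦ ((contDiffAt_comp_chart_symm hu hy).fderiv_right (m := 1)
      (by norm_num)).continuousAt.continuousWithinAt
  refine ((hf.clm_apply (continuousOn_const (c := v))).mul
    (hf.clm_apply (continuousOn_const (c := w)))).congr fun y hy ↦ ?_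
  simp only [ContinuousLinearMap.smulRight_apply, smul_apply, smul_eq_mul]
  rw [differential_coordFrame hu hy, differential_coordFrame hu hy]
  rfl

variable [RiemannianBundle (fun x : N ↦ TangentSpace (𝓡 n) x)]

theorem chartMetric_isInvertible {x : N} {y : EuclideanSpace ℝ (Fin n)}
    (hy : y ∈ (extChartAt (𝓡 n) x).target) : (chartMetric x y).IsInvertible := by
  have hinj : Function.Injective (chartMetric x y).toLinearMap := by
    refine (injective_iff_map_eq_zero _).2 fun v hv ↦ ?_
    have h1 : chartMetric x y v v = 0 := by
      have : chartMetric x y v = 0 := hv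
      rw [this]
      rfl
    rw [chartMetric_apply, inner_self_eq_zero] at h1
    exact (coordFrame_bijective hy).1 (h1.trans (map_zero _).symm)
  have hdim : Module.finrank ℝ (EuclideanSpace ℝ (Fin n)) =
      Module.finrank ℝ (EuclideanSpace ℝ (Fin n) →L[ℝ] ℝ) := by
    rw [← (LinearMap.toContinuousLinearMap (𝕜 := ℝ) (E := EuclideanSpace ℝ (Fin n))
      (F' := ℝ)).finrank_eq]
    exact Subspace.dual_finrank_eq.symm
  refine ⟨(LinearEquiv.ofInjectiveOfFinrankEq (chartMetric x y).toLinearMap hinj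
    hdim).toContinuousLinearEquiv, ?_⟩
  ext v w
  rfl

/-- The coefficients of the gradient in the coordinate frame. -/
noncomputable def gradCoeffs (u : N → ℝ) (x : N) (y : EuclideanSpace ℝ (Fin n)) :
    EuclideanSpace ℝ (Fin n) :=
  (chartMetric x y).inverse (fderiv ℝ (u ∘ (extChartAt (𝓡 n) x).symm) y)

theorem coordFrame_gradCoeffs {u : N → ℝ} (hu : ContMDiff (𝓡 n) 𝓘(ℝ, ℝ) 2 u) {x : N}
    {y : EuclideanSpace ℝ (Fin n)} (hy : y ∈ (extChartAt (𝓡 n) x).target) :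
    coordFrame x y (gradCoeffs u x y) = grad n u ((extChartAt (𝓡 n) x).symm y) := by
  refine ext_inner_right ℝ fun w ↦ ?_
  obtain ⟨b, rfl⟩ := (coordFrame_bijective hy).2 w
  rw [← chartMetric_apply]
  refine Eq.trans ?_ (inner_sharp (differential n u ((extChartAt (𝓡 n) x).symm y)) _).symm
  rw [differential_coordFrame hu hy, gradCoeffs, (chartMetric_isInvertible hy).self_apply_inverse]

omit [IsManifold (𝓡 n) ∞ N] in
theorem norm_grad_sq (u : N → ℝ) (x : N) :
    ‖grad n u x‖ ^ 2 = differential n u x (grad n u x) := by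
  rw [← real_inner_self_eq_norm_sq]
  exact inner_sharp _ _

variable [IsContMDiffRiemannianBundle (𝓡 n) ∞ (EuclideanSpace ℝ (Fin n))
      (fun x : N ↦ TangentSpace (𝓡 n) x)]

theorem continuousOn_gradCoeffs {u : N → ℝ} (hu : ContMDiff (𝓡 n) 𝓘(ℝ, ℝ) 2 u) (x : N) :
    ContinuousOn (gradCoeffs u x) (extChartAt (𝓡 n) x).target := by
  intro y hy
  refine ContinuousAt.continuousWithinAt ?_
  obtain ⟨e, he⟩ := chartMetric_isInvertible hy
  have h1 : ContinuousAt (fun z ↦ (chartMetric x z).inverse) y := by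
    refine ContinuousAt.comp (g := ContinuousLinearMap.inverse) ?_
      (differentiableAt_chartMetric hy).continuousAt
    rw [← he]
    exact (contDiffAt_map_inverse (n := 0) e).continuousAt
  exact h1.clm_apply ((contDiffAt_comp_chart_symm hu hy).fderiv_right (m := 1)
      (by norm_num)).continuousAt

theorem continuous_norm_grad_sq {u : N → ℝ} (hu : ContMDiff (𝓡 n) 𝓘(ℝ, ℝ) 2 u) :
    Continuous fun x ↦ ‖grad n u x‖ ^ 2 := by
  refine continuous_of_continuousOn_chart (n := n) fun x ↦ ?_
  have hf : ContinuousOn (fderiv ℝ (u ∘ (extChartAt (𝓡 n) x).symm)) (extChartAt (𝓡 n) x).target :=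
    fun y hy ↦ ((contDiffAt_comp_chart_symm hu hy).fderiv_right (m := 1)
      (by norm_num)).continuousAt.continuousWithinAt
  refine (hf.clm_apply (continuousOn_gradCoeffs hu x)).congr fun y hy ↦ ?_
  simp only [Function.comp_apply]
  rw [norm_grad_sq, ← coordFrame_gradCoeffs hu hy, differential_coordFrame hu hy]

theorem hasContinuousCoeffs_metricTensor :
    HasContinuousCoeffs (metricTensor (n := n) (N := N)) := by
  intro x v w
  exact ((contDiffOn_chartMetric x).continuousOn.clm_apply continuousOn_const).clm_apply
    continuousOn_const

/-- `hessian` is defined with a different chart at each point, which hides its continuity. Chart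
independence allows one fixed chart, where all ingredients are continuous. -/
theorem hasContinuousCoeffs_hessian {u : N → ℝ} (hu : ContMDiff (𝓡 n) 𝓘(ℝ, ℝ) 2 u) :
    HasContinuousCoeffs (hessian (n := n) u) := by
  intro x v w
  have hf : ContinuousOn (fderiv ℝ (fderiv ℝ (u ∘ (extChartAt (𝓡 n) x).symm)))
      (extChartAt (𝓡 n) x).target := fun y hy ↦
    (((contDiffAt_comp_chart_symm hu hy).fderiv_right (m := 1) (by norm_num)).fderiv_right
      (m := 0) (by norm_num)).continuousAt.continuousWithinAt
  have hZ := continuousOn_gradCoeffs hu x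
  have hB' {a b c : EuclideanSpace ℝ (Fin n) → EuclideanSpace ℝ (Fin n)}
      (ha : ContinuousOn a (extChartAt (𝓡 n) x).target)
      (hb : ContinuousOn b (extChartAt (𝓡 n) x).target)
      (hc : ContinuousOn c (extChartAt (𝓡 n) x).target) :
      ContinuousOn (fun y ↦ fderiv ℝ (chartMetric x) y (a y) (b y) (c y))
        (extChartAt (𝓡 n) x).target := 
    ((continuousOn_fderiv_apply ((contDiffOn_chartMetric x).of_le (by simp))
      (isOpen_chart_target x) ha).clm_apply hb).clm_apply hc
  have hv := continuousOn_const (s := (extChartAt (𝓡 n) x).target) (c := v)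
  have hw := continuousOn_const (s := (extChartAt (𝓡 n) x).target) (c := w)
  refine ContinuousOn.congr (f := fun y ↦ coordHessian (u ∘ (extChartAt (𝓡 n) x).symm)
    (chartMetric x) y (gradCoeffs u x y) v w) ?_ fun y hy ↦ ?_
  · exact ((hf.clm_apply hv).clm_apply hw).sub
      ((((hB' hv hZ hw).add (hB' hw hZ hv)).sub (hB' hZ hv hw)).const_mul _)
  · exact hessian_coordFrame hu hy (coordFrame_gradCoeffs hu hy) v w

theorem hasContinuousCoeffs_conformalHessian {S : TwoTensor n N} (hS : IsContinuousTensor S)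
    {u : N → ℝ} (hu : ContMDiff (𝓡 n) 𝓘(ℝ, ℝ) 2 u) :
    HasContinuousCoeffs (conformalHessian S u) :=
  (((hasContinuousCoeffs_hessian hu).add (hasContinuousCoeffs_differential hu)).sub
    (hasContinuousCoeffs_metricTensor.smul ((continuous_norm_grad_sq hu).div_const 2))).add
    hS.hasContinuousCoeffs

end Riemannian

end Continuity

theorem coordHessian_symm {E : Type*} [NormedAddCommGroup E] [NormedSpace ℝ E]
    {f : E → ℝ} {B : E → E →L[ℝ] E →L[ℝ] ℝ} {y : E} (hf : ContDiffAt ℝ 2 f y)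
    (hB : DifferentiableAt ℝ B y) (hsymm : ∀ z v w, B z v w = B z w v) (Z v w : E) :
    coordHessian f B y Z v w = coordHessian f B y Z w v := by
  have h1 : fderiv ℝ (fderiv ℝ f) y v w = fderiv ℝ (fderiv ℝ f) y w v :=
    hf.isSymmSndFDerivAt (by simp) v w
  have h2 : fderiv ℝ B y Z v w = fderiv ℝ B y Z w v := by
    rw [fderiv_apply_apply hB, fderiv_apply_apply hB]
    simp_rw [hsymm _ v w]
  rw [coordHessian, coordHessian, h1, h2]
  ring

theorem coordHessian_zero {E : Type*} [NormedAddCommGroup E] [NormedSpace ℝ E]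
    (f : E → ℝ) (B : E → E →L[ℝ] E →L[ℝ] ℝ) (y v w : E) :
    coordHessian f B y 0 v w = fderiv ℝ (fderiv ℝ f) y v w := by
  simp [coordHessian]

theorem tendsto_sub_one_div_smul {G : Type*} [NormedAddCommGroup G] [NormedSpace ℝ G] (a b : G) :
    Tendsto (fun k : ℕ ↦ a - (1 / ((k : ℝ) + 1)) • b) atTop (𝓝 a) := by
  have := (tendsto_one_div_add_atTop_nhds_zero_nat (𝕜 := ℝ)).smul_const b
  simpa using this.const_sub a

theorem exists_nat_posDef_sub {E : Type*} [NormedAddCommGroup E] [NormedSpace ℝ E]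
    [FiniteDimensional ℝ E] {B : E →L[ℝ] E →L[ℝ] ℝ} (hB : ∀ v, v ≠ 0 → 0 < B v v)
    (B' : E →L[ℝ] E →L[ℝ] ℝ) :
    ∃ k : ℕ, ∀ v, v ≠ 0 → 0 < (B - (1 / ((k : ℝ) + 1)) • B') v v :=
  ((tendsto_sub_one_div_smul B B').eventually (eventually_posDef hB)).exists

/-! ### Symmetry of the conformal Hessian, and its comparison with `S` at extrema. -/

section Pointwise

variable {n : ℕ} {N : Type*} [TopologicalSpace N] [ChartedSpace (EuclideanSpace ℝ (Fin n)) N]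

theorem differential_apply {u : N → ℝ} (hu : ContMDiff (𝓡 n) 𝓘(ℝ, ℝ) 2 u) (p : N)
    (a : EuclideanSpace ℝ (Fin n)) :
    (differential n u p : EuclideanSpace ℝ (Fin n) →L[ℝ] ℝ) a =
      fderiv ℝ (u ∘ (extChartAt (𝓡 n) p).symm) (extChartAt (𝓡 n) p p) a := by
  have h : (differential n u p : EuclideanSpace ℝ (Fin n) →L[ℝ] ℝ) =
      fderiv ℝ (u ∘ (extChartAt (𝓡 n) p).symm) (extChartAt (𝓡 n) p p) := by
    refine (hu.mdifferentiableAt (x := p) (by simp)).mfderiv.trans ?_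
    rw [(𝓡 n).range_eq_univ, fderivWithin_univ]
    rfl
  exact congrArg (fun L : EuclideanSpace ℝ (Fin n) →L[ℝ] ℝ ↦ L a) h

variable [RiemannianBundle (fun x : N ↦ TangentSpace (𝓡 n) x)]

theorem conformalHessian_apply (S : TwoTensor n N) (u : N → ℝ) (x : N)
    (v w : TangentSpace (𝓡 n) x) :
    conformalHessian S u x v w = hessian u x v w + differential n u x v * differential n u x w
      - ‖grad n u x‖ ^ 2 / 2 * inner ℝ v w + S x v w := rfl

variable [IsManifold (𝓡 n) ∞ N]

theorem hessian_symm [IsContMDiffRiemannianBundle (𝓡 n) ∞ (EuclideanSpace ℝ (Fin n))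
      (fun x : N ↦ TangentSpace (𝓡 n) x)]
    {u : N → ℝ} (hu : ContMDiff (𝓡 n) 𝓘(ℝ, ℝ) 2 u) (x : N) (v w : TangentSpace (𝓡 n) x) :
    hessian u x v w = hessian u x w v := by
  refine (hessian_apply u x v w).trans (Eq.trans ?_ (hessian_apply u x w v).symm)
  exact coordHessian_symm (contDiffAt_comp_chart_symm hu (mem_extChartAt_target x))
    (differentiableAt_chartMetric (mem_extChartAt_target x)) (chartMetric_symm x) _ _ _

theorem conformalHessian_symm [IsContMDiffRiemannianBundle (𝓡 n) ∞ (EuclideanSpace ℝ (Fin n))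
      (fun x : N ↦ TangentSpace (𝓡 n) x)] {S : TwoTensor n N}
    (hS : ∀ (x : N) (v w : TangentSpace (𝓡 n) x), S x v w = S x w v)
    {u : N → ℝ} (hu : ContMDiff (𝓡 n) 𝓘(ℝ, ℝ) 2 u) (x : N) (v w : TangentSpace (𝓡 n) x) :
    conformalHessian S u x v w = conformalHessian S u x w v := by
  rw [conformalHessian_apply, conformalHessian_apply, hessian_symm hu, hS, real_inner_comm,
    mul_comm (differential n u x v)]

omit [IsManifold (𝓡 n) ∞ N] in
theorem grad_eq_zero_of_isLocalExtr {u : N → ℝ} (hu : ContMDiff (𝓡 n) 𝓘(ℝ, ℝ) 2 u) {p : N}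
    (hp : IsLocalExtr (u ∘ (extChartAt (𝓡 n) p).symm) (extChartAt (𝓡 n) p p)) :
    grad n u p = 0 := by
  have h : ∀ v : TangentSpace (𝓡 n) p, differential n u p v = 0 := fun v ↦ by
    refine (differential_apply hu p v).trans ?_
    rw [hp.fderiv_eq_zero]
    rfl
  refine ext_inner_right ℝ fun w ↦ ?_
  rw [inner_zero_left]
  exact (inner_sharp _ _).trans (h w)

omit [IsManifold (𝓡 n) ∞ N] in
theorem hessian_eq_of_grad_eq_zero {u : N → ℝ} {p : N} (hp : grad n u p = 0)
    (v : TangentSpace (𝓡 n) p) :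
    hessian u p v v =
      fderiv ℝ (fderiv ℝ (u ∘ (extChartAt (𝓡 n) p).symm)) (extChartAt (𝓡 n) p p) v v := by
  have h0 : (grad n u p : EuclideanSpace ℝ (Fin n)) = (0 : EuclideanSpace ℝ (Fin n)) := hp
  refine (hessian_apply u p v v).trans ?_
  rw [h0]
  exact coordHessian_zero _ _ _ _ _

omit [IsManifold (𝓡 n) ∞ N] in
theorem conformalHessian_of_grad_eq_zero {S : TwoTensor n N} {u : N → ℝ} {p : N}
    (hp : grad n u p = 0) (v : TangentSpace (𝓡 n) p) :
    conformalHessian S u p v v = hessian u p v v + S p v v := by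
  have h : differential n u p v = 0 := by
    have h1 := inner_sharp (differential n u p) v
    rw [← h1]
    change inner ℝ (grad n u p) v = 0
    rw [hp, inner_zero_left]
  rw [conformalHessian_apply, h, hp]
  simp

omit [RiemannianBundle (fun x : N ↦ TangentSpace (𝓡 n) x)] [IsManifold (𝓡 n) ∞ N] in
theorem isLocalMin_chart {u : N → ℝ} {p : N} (hp : ∀ x, u p ≤ u x) :
    IsLocalMin (u ∘ (extChartAt (𝓡 n) p).symm) (extChartAt (𝓡 n) p p) :=
  Eventually.of_forall fun z ↦ by
    simp only [Function.comp_apply, extChartAt_to_inv]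
    exact hp _

omit [RiemannianBundle (fun x : N ↦ TangentSpace (𝓡 n) x)] [IsManifold (𝓡 n) ∞ N] in
theorem isLocalMax_chart {u : N → ℝ} {p : N} (hp : ∀ x, u x ≤ u p) :
    IsLocalMax (u ∘ (extChartAt (𝓡 n) p).symm) (extChartAt (𝓡 n) p p) :=
  Eventually.of_forall fun z ↦ by
    simp only [Function.comp_apply, extChartAt_to_inv]
    exact hp _

/-- At a minimum the gradient terms vanish, and the Hessian is the plain second derivative, which is
nonnegative. -/
theorem le_conformalHessian_of_isMin {S : TwoTensor n N} {u : N → ℝ}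
    (hu : ContMDiff (𝓡 n) 𝓘(ℝ, ℝ) 2 u) {p : N} (hp : ∀ x, u p ≤ u x)
    (v : TangentSpace (𝓡 n) p) : S p v v ≤ conformalHessian S u p v v := by
  have hg := grad_eq_zero_of_isLocalExtr hu (Or.inl (isLocalMin_chart hp))
  rw [conformalHessian_of_grad_eq_zero hg, hessian_eq_of_grad_eq_zero hg]
  have := fderiv_fderiv_nonneg_of_isLocalMin
    (contDiffAt_comp_chart_symm hu (mem_extChartAt_target p)) (isLocalMin_chart hp) v
  exact le_add_of_nonneg_left this

theorem conformalHessian_le_of_isMax {S : TwoTensor n N} {u : N → ℝ}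
    (hu : ContMDiff (𝓡 n) 𝓘(ℝ, ℝ) 2 u) {p : N} (hp : ∀ x, u x ≤ u p)
    (v : TangentSpace (𝓡 n) p) : conformalHessian S u p v v ≤ S p v v := by
  have hg := grad_eq_zero_of_isLocalExtr hu (Or.inr (isLocalMax_chart hp))
  rw [conformalHessian_of_grad_eq_zero hg, hessian_eq_of_grad_eq_zero hg]
  have := fderiv_fderiv_nonpos_of_isLocalMax
    (contDiffAt_comp_chart_symm hu (mem_extChartAt_target p)) (isLocalMax_chart hp) v
  exact add_le_of_nonpos_left this

end Pointwise

/-! ### Uniform bounds by compactness, and global positivity by connectedness. -/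

section Compact

variable {n : ℕ} {N : Type*} [TopologicalSpace N] [ChartedSpace (EuclideanSpace ℝ (Fin n)) N]
  [RiemannianBundle (fun x : N ↦ TangentSpace (𝓡 n) x)] [IsManifold (𝓡 n) ∞ N] [CompactSpace N]

/-- On a compact manifold, a positive definite tensor field remains positive definite after
subtracting a small multiple of another one. -/
theorem exists_smul_le_of_posDef {T T' : TwoTensor n N} (hT : HasContinuousCoeffs T)
    (hT' : HasContinuousCoeffs T') (hpos : ∀ x, IsPosDefAt T x) (hpos' : ∀ x, IsPosDefAt T' x) :
    ∃ ε : ℝ, 0 < ε ∧ ∀ (x : N) (v : TangentSpace (𝓡 n) x), ε * T' x v v ≤ T x v v := by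
  -- These sets are open, increase with `k` and cover `N`, so one of them is all of `N`.
  set U : ℕ → Set N := fun k ↦ {q | IsPosDefAt (fun x ↦ T x - (1 / ((k : ℝ) + 1)) • T' x) q}
  have hU : ∀ k, IsOpen (U k) := fun k ↦
    (hT.sub (hT'.smul (c := fun _ ↦ 1 / ((k : ℝ) + 1)) continuous_const)).isOpen_isPosDefAt
  have hcover : univ ⊆ ⋃ k, U k := fun q _ ↦ by
    obtain ⟨k, hk⟩ := exists_nat_posDef_sub (E := TangentSpace (𝓡 n) q) (hpos q) (T' q)
    exact mem_iUnion.2 ⟨k, hk⟩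
  have hmono : Monotone U := fun k l hkl q hq v hv ↦ by
    have h1 : 0 < T q v v - (1 / ((k : ℝ) + 1)) * T' q v v := hq v hv
    have h2 : 1 / ((l : ℝ) + 1) ≤ 1 / ((k : ℝ) + 1) := by gcongr
    have h3 := mul_le_mul_of_nonneg_right h2 (hpos' q v hv).le
    change 0 < T q v v - (1 / ((l : ℝ) + 1)) * T' q v v
    linarith
  obtain ⟨k, hk⟩ := isCompact_univ.elim_directed_cover U hU hcover hmono.directed_le
  refine ⟨1 / ((k : ℝ) + 1), by positivity, fun x v ↦ ?_⟩
  by_cases hv : v = 0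
  · simp [hv]
  have h1 : 0 < T x v v - (1 / ((k : ℝ) + 1)) * T' x v v := hk (mem_univ x) v hv
  linarith

variable [IsContMDiffRiemannianBundle (𝓡 n) ∞ (EuclideanSpace ℝ (Fin n))
      (fun x : N ↦ TangentSpace (𝓡 n) x)]

omit [IsManifold (𝓡 n) ∞ N] [CompactSpace N] [IsContMDiffRiemannianBundle (𝓡 n) ∞
    (EuclideanSpace ℝ (Fin n)) (fun x : N ↦ TangentSpace (𝓡 n) x)] in
theorem isPosDefAt_metricTensor (x : N) : IsPosDefAt (metricTensor (n := n) (N := N)) x :=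
  fun _ hv ↦ real_inner_self_pos.2 hv

theorem exists_pos_le_of_posDef {S : TwoTensor n N} (hS : IsContinuousTensor S)
    (hpos : ∀ x, IsPosDefAt S x) :
    ∃ c : ℝ, 0 < c ∧ ∀ (x : N) (v : TangentSpace (𝓡 n) x), c * ‖v‖ ^ 2 ≤ S x v v := by
  obtain ⟨c, hc, h⟩ := exists_smul_le_of_posDef hS.hasContinuousCoeffs
    hasContinuousCoeffs_metricTensor hpos isPosDefAt_metricTensor
  refine ⟨c, hc, fun x v ↦ ?_⟩
  rw [← real_inner_self_eq_norm_sq]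
  exact h x v

theorem le_lambdaMax {S : TwoTensor n N} (hS : IsContinuousTensor S)
    (hsymm : ∀ (x : N) (v w : TangentSpace (𝓡 n) x), S x v w = S x w v)
    (hpos : ∀ x, IsPosDefAt S x) (x : N) (v : TangentSpace (𝓡 n) x) :
    S x v v ≤ lambdaMax S * ‖v‖ ^ 2 := by
  obtain ⟨c, hc, h⟩ := exists_smul_le_of_posDef hasContinuousCoeffs_metricTensor
    hS.hasContinuousCoeffs isPosDefAt_metricTensor hpos
  -- `sSup` in ℝ bounds only sets that are bounded above. Here `c S ≤ g` bounds every eigenvalue by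
  -- `1 / c`.
  have hbdd : BddAbove {l : ℝ | ∃ x : N,
      Module.End.HasEigenvalue (toEndo (S x)).toLinearMap l} := by
    refine ⟨1 / c, ?_⟩
    rintro l ⟨x, hl⟩
    obtain ⟨v, hv⟩ := hl.exists_hasEigenvector
    have h1 : toEndo (S x) v = l • v := hv.apply_eq_smul
    have h2 : S x v v = l * ‖v‖ ^ 2 := by
      rw [← inner_toEndo, h1, real_inner_smul_left, real_inner_self_eq_norm_sq]
    have h3 : c * S x v v ≤ ‖v‖ ^ 2 := by
      rw [← real_inner_self_eq_norm_sq]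
      exact h x v
    have h4 : 0 < ‖v‖ ^ 2 := by
      have := norm_pos_iff.2 hv.2
      positivity
    rw [le_div_iff₀ hc]
    rw [h2] at h3
    nlinarith
  exact apply_self_le_of_hasEigenvalue_le (hsymm x) (fun l hl ↦ le_csSup hbdd ⟨x, hl⟩) v

/-- The connectedness of `N` propagates the positivity at the minimum of a solution. -/
theorem conformalHessian_isPosDefAt [ConnectedSpace N] (hn : 1 ≤ n)
    {S : TwoTensor n N} (hS : IsContinuousTensor S)
    (hsymm : ∀ (x : N) (v w : TangentSpace (𝓡 n) x), S x v w = S x w v)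
    (hpos : ∀ x, IsPosDefAt S x) {u : N → ℝ} (hu : IsSolution S u) (x : N) :
    IsPosDefAt (conformalHessian S u) x := by
  have hcoef := hasContinuousCoeffs_conformalHessian hS hu.1
  have hdet (q : N) : (toEndo (conformalHessian S u q)).det ≠ 0 := fun h0 ↦ by
    have h1 := (hu.2 q).2
    have hn' : (1 / n : ℝ) ≠ 0 := by positivity
    rw [h0, Real.zero_rpow hn'] at h1
    exact (Real.exp_pos _).ne h1
  have hiff (q : N) (h : ∀ v : TangentSpace (𝓡 n) q, 0 ≤ conformalHessian S u q v v) :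
      IsPosDefAt (conformalHessian S u) q := fun v hv ↦
    lt_of_le_of_ne (h v) fun h0 ↦ apply_ne_zero_of_det_ne_zero (hdet q) hv
      (apply_eq_zero_of_apply_self_eq_zero (conformalHessian_symm hsymm hu.1 q) h h0.symm)
  -- As the determinant is nonzero, semidefinite already means definite: one description gives a
  -- closed set, the other an open one.
  have hset : {q | IsPosDefAt (conformalHessian S u) q} =
      {q | ∀ v : TangentSpace (𝓡 n) q, 0 ≤ conformalHessian S u q v v} := by
    ext q
    refine ⟨fun h v ↦ ?_, hiff q⟩
    by_cases hv : v = 0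
    · simp [hv]
    · exact (h v hv).le
  have hclopen : IsClopen {q | IsPosDefAt (conformalHessian S u) q} :=
    ⟨hset ▸ hcoef.isClosed_nonneg, hcoef.isOpen_isPosDefAt⟩
  obtain ⟨p, -, hp⟩ := isCompact_univ.exists_isMinOn univ_nonempty
    (f := u) hu.1.continuous.continuousOn
  have hne : {q | IsPosDefAt (conformalHessian S u) q}.Nonempty := ⟨p, fun v hv ↦
    (hpos p v hv).trans_le (le_conformalHessian_of_isMin hu.1 (fun x ↦ hp (mem_univ x)) v)⟩
  have := hclopen.eq_univ hne
  exact (this ▸ mem_univ x : x ∈ {q | IsPosDefAt (conformalHessian S u) q})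

end Compact

/-! ### The gradient estimate. -/

section Gradient

variable {n : ℕ} {N : Type*} [TopologicalSpace N] [ChartedSpace (EuclideanSpace ℝ (Fin n)) N]
  [RiemannianBundle (fun x : N ↦ TangentSpace (𝓡 n) x)]

theorem abs_differential_le (u : N → ℝ) (x : N) (v : TangentSpace (𝓡 n) x) :
    |differential n u x v| ≤ ‖grad n u x‖ * ‖v‖ := by
  have h := abs_real_inner_le_norm (grad n u x) v
  rwa [show inner ℝ (grad n u x) v = differential n u x v from inner_sharp _ _] at h

variable [IsManifold (𝓡 n) ∞ N] [IsContMDiffRiemannianBundle (𝓡 n) ∞ (EuclideanSpace ℝ (Fin n))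
      (fun x : N ↦ TangentSpace (𝓡 n) x)]

/-- The first order condition at a maximum of `exp u * (‖∇u‖² + c)`. -/
theorem hessian_grad_grad_of_isMax {u : N → ℝ} (hu : ContMDiff (𝓡 n) 𝓘(ℝ, ℝ) 2 u) {c : ℝ} {p : N}
    (hp : ∀ x, Real.exp (u x) * (‖grad n u x‖ ^ 2 + c) ≤ Real.exp (u p) * (‖grad n u p‖ ^ 2 + c))
    (h0 : grad n u p ≠ 0) :
    ‖grad n u p‖ ^ 2 * (‖grad n u p‖ ^ 2 + c)
      + 2 * hessian u p (grad n u p) (grad n u p) = 0 := by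
  obtain ⟨y, hy, hyp⟩ := exists_chart_symm_eq (n := n) p
  generalize hx : p = x at hy hyp
  subst hx
  revert hp h0
  -- Stated for a free point `q`, so that `q` can be replaced by the image of `y`, the point to
  -- which `coordFrame p y` is attached.
  suffices H : ∀ q, (extChartAt (𝓡 n) p).symm y = q →
      (∀ x, Real.exp (u x) * (‖grad n u x‖ ^ 2 + c) ≤
        Real.exp (u q) * (‖grad n u q‖ ^ 2 + c)) → grad n u q ≠ 0 →
      ‖grad n u q‖ ^ 2 * (‖grad n u q‖ ^ 2 + c)
        + 2 * hessian u q (grad n u q) (grad n u q) = 0 from H p hyp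
  rintro q rfl hp h0
  set f := u ∘ (extChartAt (𝓡 n) p).symm with hf
  set W := gradCoeffs u p y with hW
  have hWg : coordFrame p y W = grad n u ((extChartAt (𝓡 n) p).symm y) :=
    coordFrame_gradCoeffs hu hy
  set q := (extChartAt (𝓡 n) p).symm y with hq
  have hBW : chartMetric p y W W = ‖grad n u q‖ ^ 2 := by
    rw [chartMetric_apply, hWg, real_inner_self_eq_norm_sq]
  have hfW : fderiv ℝ f y W = ‖grad n u q‖ ^ 2 := by
    rw [← differential_coordFrame hu hy, hWg]
    exact (norm_grad_sq u q).symm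
  have hne : ‖grad n u q‖ ^ 2 ≠ 0 := by
    have := norm_pos_iff.2 h0
    positivity
  have hder := hasDerivAt_exp_mul_lowerGradient (contDiffAt_comp_chart_symm hu hy)
    (differentiableAt_chartMetric hy) hne hBW hfW c
  have hline : Tendsto (fun t : ℝ ↦ y + t • W) (𝓝 0) (𝓝 y) := by
    have : Continuous fun t : ℝ ↦ y + t • W := by fun_prop
    simpa using this.tendsto 0
  -- The frozen-direction function lies below the true one and agrees with it at `t = 0`, so it
  -- inherits the maximum.
  have hmax : IsLocalMax (fun t : ℝ ↦ Real.exp (f (y + t • W)) *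
        ((fderiv ℝ f (y + t • W) W) ^ 2 / chartMetric p (y + t • W) W W + c)) 0 := by
    filter_upwards [hline.eventually ((isOpen_chart_target p).mem_nhds hy)] with t ht
    have h1 : (fderiv ℝ f (y + t • W) W) ^ 2 / chartMetric p (y + t • W) W W ≤
        ‖grad n u ((extChartAt (𝓡 n) p).symm (y + t • W))‖ ^ 2 := by
      rw [← differential_coordFrame hu ht, chartMetric_apply, real_inner_self_eq_norm_sq]
      refine div_le_of_le_mul₀ (by positivity) (by positivity) ?_
      rw [← mul_pow, ← sq_abs]
      exact pow_le_pow_left₀ (abs_nonneg _) (abs_differential_le _ _ _) 2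
    have h2 : fderiv ℝ f (y + (0 : ℝ) • W) W ^ 2 / chartMetric p (y + (0 : ℝ) • W) W W =
        ‖grad n u q‖ ^ 2 := by
      rw [zero_smul, add_zero, hBW, hfW, pow_two, mul_self_div_self]
    rw [h2, zero_smul, add_zero]
    refine le_trans ?_ (hp ((extChartAt (𝓡 n) p).symm (y + t • W)))
    exact mul_le_mul_of_nonneg_left (by linarith) (Real.exp_pos _).le
  have hzero := hmax.hasDerivAt_eq_zero hder
  rw [← hessian_coordFrame hu hy hWg W W, hWg] at hzero
  exact (mul_eq_zero.1 hzero).resolve_left (Real.exp_pos _).ne'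

/-- The gradient estimate: if the conformal Hessian is positive definite, then
`‖∇u‖² ≤ 2 λ (exp (max u - u) - 1)`, where `λ` is an upper bound for `S`. -/
theorem norm_grad_sq_le [CompactSpace N] [Nonempty N] {S : TwoTensor n N} {u : N → ℝ}
    (hu : ContMDiff (𝓡 n) 𝓘(ℝ, ℝ) 2 u) (hA : ∀ x, IsPosDefAt (conformalHessian S u) x)
    {l : ℝ} (hl : 0 ≤ l) (hS : ∀ (x : N) (v : TangentSpace (𝓡 n) x), S x v v ≤ l * ‖v‖ ^ 2)
    {M : ℝ} (hM : ∀ x, u x ≤ M) (x : N) :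
    ‖grad n u x‖ ^ 2 ≤ 2 * l * (Real.exp (M - u x) - 1) := by
  have hF : Continuous fun x ↦ Real.exp (u x) * (‖grad n u x‖ ^ 2 + 2 * l) :=
    (Real.continuous_exp.comp hu.continuous).mul
      ((continuous_norm_grad_sq hu).add continuous_const)
  obtain ⟨p, -, hp⟩ := isCompact_univ.exists_isMaxOn univ_nonempty hF.continuousOn
  have hp' : ∀ x, Real.exp (u x) * (‖grad n u x‖ ^ 2 + 2 * l) ≤
      Real.exp (u p) * (‖grad n u p‖ ^ 2 + 2 * l) := fun x ↦ hp (mem_univ x)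
  -- Otherwise the first order condition cancels all gradient terms in A(∇u, ∇u), leaving S(∇u, ∇u)
  -- - l |∇u|² ≤ 0. The shift 2l is chosen for this cancellation.
  have hg : grad n u p = 0 := by
    by_contra h0
    have h1 := hessian_grad_grad_of_isMax hu hp' h0
    have h2 := hA p _ h0
    rw [conformalHessian_apply, real_inner_self_eq_norm_sq, ← norm_grad_sq] at h2
    have h3 := hS p (grad n u p)
    nlinarith
  have h1 := hp' x
  rw [hg, norm_zero] at h1
  have h2 : Real.exp (u p) ≤ Real.exp M := Real.exp_le_exp.2 (hM p)
  have h3 : Real.exp (u x) * (‖grad n u x‖ ^ 2 + 2 * l) ≤ Real.exp M * (2 * l) :=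
    h1.trans (by nlinarith)
  have h4 : Real.exp (M - u x) * Real.exp (u x) = Real.exp M := by
    rw [← Real.exp_add]
    ring_nf
  have h5 := Real.exp_pos (u x)
  rw [← h4] at h3
  have h6 : ‖grad n u x‖ ^ 2 + 2 * l ≤ Real.exp (M - u x) * (2 * l) := by
    refine le_of_mul_le_mul_left ?_ h5
    linarith
  linarith

end Gradient

/-! ### From gradient bounds to Lipschitz bounds, and the derivative of the arccosine. -/

/-- A function whose differential is bounded by `K` is `K`-Lipschitz for the Riemannian distance. -/
theorem abs_sub_le_of_differential_le {n : ℕ} {N : Type*} [MetricSpace N]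
    [ChartedSpace (EuclideanSpace ℝ (Fin n)) N] [IsManifold (𝓡 n) ∞ N]
    [RiemannianBundle (fun x : N ↦ TangentSpace (𝓡 n) x)]
    [IsRiemannianManifold (𝓡 n) N] {g : N → ℝ} (hg : ContMDiff (𝓡 n) 𝓘(ℝ, ℝ) 1 g)
    {K : NNReal} (hK : ∀ (x : N) (v : TangentSpace (𝓡 n) x), |differential n g x v| ≤ K * ‖v‖)
    (x y : N) : |g x - g y| ≤ K * dist x y := by
  -- The distance is an infimum of lengths that need not be attained, so the curve is taken of
  -- length below some `r > dist x y`.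
  have h : ∀ r > dist x y, |g x - g y| ≤ K * r := by
    intro r hr
    have hr0 : 0 ≤ r := dist_nonneg.trans hr.le
    have h1 : riemannianEDist (𝓡 n) x y < ENNReal.ofReal r := by
      rw [← IsRiemannianManifold.out (I := 𝓡 n) x y, edist_dist]
      exact (ENNReal.ofReal_lt_ofReal_iff_of_nonneg dist_nonneg).2 hr
    obtain ⟨γ, h0, h1, hγ, hlen⟩ := exists_lt_of_riemannianEDist_lt h1
    have hgγ : ContDiffOn ℝ 1 (g ∘ γ) (Icc 0 1) :=
      contMDiffOn_iff_contDiffOn.1 (hg.comp_contMDiffOn hγ)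
    have h2 := enorm_sub_le_lintegral_derivWithin_Icc_of_contDiffOn_Icc hgγ zero_le_one
    have h3 : ∫⁻ t in Icc (0 : ℝ) 1, ‖derivWithin (g ∘ γ) (Icc 0 1) t‖ₑ ≤
        K * pathELength (𝓡 n) γ 0 1 := by
      rw [pathELength_eq_lintegral_mfderivWithin_Icc,
        ← MeasureTheory.lintegral_const_mul' _ _ ENNReal.coe_ne_top]
      refine MeasureTheory.setLIntegral_mono' measurableSet_Icc fun t ht ↦ ?_
      have h4 := mfderivWithin_comp (I := 𝓘(ℝ, ℝ)) (I' := 𝓡 n) (I'' := 𝓘(ℝ, ℝ)) t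
        (hg.mdifferentiableAt one_ne_zero).mdifferentiableWithinAt
        (hγ.mdifferentiableOn one_ne_zero t ht) (subset_univ _)
        ((uniqueDiffOn_Icc zero_lt_one).uniqueMDiffOn t ht) (u := univ) (g := g)
      rw [mfderivWithin_univ, mfderivWithin_eq_fderivWithin] at h4
      have h5 : derivWithin (g ∘ γ) (Icc 0 1) t =
          differential n g (γ t) (mfderivWithin 𝓘(ℝ, ℝ) (𝓡 n) γ (Icc 0 1) t 1) := by
        rw [← fderivWithin_derivWithin, h4]
        rfl
      rw [h5, ← ofReal_norm, ← ofReal_norm, ← ENNReal.ofReal_coe_nnreal,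
        ← ENNReal.ofReal_mul K.coe_nonneg]
      exact ENNReal.ofReal_le_ofReal (hK _ _)
    have h6 : ‖g y - g x‖ₑ ≤ ENNReal.ofReal (K * r) := by
      rw [ENNReal.ofReal_mul K.coe_nonneg, ENNReal.ofReal_coe_nnreal]
      have h7 := h2.trans (h3.trans (mul_le_mul_right hlen.le _))
      simpa [h0, h1] using h7
    rw [← ofReal_norm, ENNReal.ofReal_le_ofReal_iff (by positivity), Real.norm_eq_abs,
      abs_sub_comm] at h6
    exact h6
  have hlim : Tendsto (fun r : ℝ ↦ K * r) (𝓝[>] dist x y) (𝓝 (K * dist x y)) :=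
    ((continuous_const.mul continuous_id).tendsto (dist x y)).mono_left nhdsWithin_le_nhds
  exact ge_of_tendsto hlim (eventually_nhdsWithin_of_forall fun r hr ↦ h r hr)

theorem contDiffAt_arccos_exp {a s : ℝ} (hs : s < a) :
    ContDiffAt ℝ 1 (fun s : ℝ ↦ Real.arccos (Real.exp ((s - a) / 2))) s := by
  have h1 : Real.exp ((s - a) / 2) < 1 := Real.exp_lt_one_iff.2 (by linarith)
  have h2 : ContDiffAt ℝ 1 (fun s : ℝ ↦ Real.exp ((s - a) / 2)) s := by fun_prop
  have h3 : Real.exp ((s - a) / 2) ≠ -1 := by linarith [Real.exp_pos ((s - a) / 2)]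
  exact ContDiffAt.comp (g := Real.arccos) s (Real.contDiffAt_arccos h3 h1.ne) h2

theorem hasDerivAt_arccos_exp {a s : ℝ} (hs : s < a) :
    HasDerivAt (fun s : ℝ ↦ Real.arccos (Real.exp ((s - a) / 2)))
      (-(1 / √(1 - Real.exp ((s - a) / 2) ^ 2)) * (Real.exp ((s - a) / 2) * (1 / 2))) s := by
  have h1 : Real.exp ((s - a) / 2) < 1 := Real.exp_lt_one_iff.2 (by linarith)
  have h2 : HasDerivAt (fun s : ℝ ↦ Real.exp ((s - a) / 2))
      (Real.exp ((s - a) / 2) * (1 / 2)) s :=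
    (((hasDerivAt_id s).sub_const a).div_const 2).exp
  have h3 : Real.exp ((s - a) / 2) ≠ -1 := by linarith [Real.exp_pos ((s - a) / 2)]
  exact HasDerivAt.comp (h₂ := Real.arccos) s (Real.hasDerivAt_arccos h3 h1.ne) h2

/-- The derivative of `arccos (exp ((u - a) / 2))` is at most `√(l / 2)` if `M < a` and
`r = ‖∇u‖` satisfies the gradient estimate. -/
theorem abs_deriv_arccos_exp_mul_le {a M s l r : ℝ} (hs : s ≤ M) (hM : M < a) (hl : 0 ≤ l)
    (h : r ^ 2 ≤ 2 * l * (Real.exp (M - s) - 1)) :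
    |-(1 / √(1 - Real.exp ((s - a) / 2) ^ 2)) * (Real.exp ((s - a) / 2) * (1 / 2))| * r
      ≤ √(l / 2) := by
  have hE : Real.exp ((s - a) / 2) ^ 2 = Real.exp (s - a) := by
    rw [← Real.exp_nat_mul]
    congr 1
    push_cast
    ring
  have h1 : Real.exp (s - a) < 1 := Real.exp_lt_one_iff.2 (by linarith)
  have h2 : Real.exp (s - a) * Real.exp (M - s) ≤ 1 := by
    rw [← Real.exp_add]
    exact Real.exp_le_one_iff.2 (by linarith)
  have h3 := Real.exp_pos (s - a)
  have hd : 0 < 1 - Real.exp (s - a) := by linarith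
  refine Real.le_sqrt_of_sq_le ?_
  rw [mul_pow, sq_abs, mul_pow, neg_sq, div_pow, mul_pow, hE, Real.sq_sqrt hd.le, one_pow]
  have h4 : Real.exp (s - a) * r ^ 2 ≤ 2 * l * (1 - Real.exp (s - a)) := by
    calc Real.exp (s - a) * r ^ 2
        ≤ Real.exp (s - a) * (2 * l * (Real.exp (M - s) - 1)) :=
          mul_le_mul_of_nonneg_left h h3.le
      _ = 2 * l * (Real.exp (s - a) * Real.exp (M - s) - Real.exp (s - a)) := by ring
      _ ≤ _ := mul_le_mul_of_nonneg_left (by linarith) (by positivity)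
  calc 1 / (1 - Real.exp (s - a)) * (Real.exp (s - a) * (1 / 2) ^ 2) * r ^ 2
      = (Real.exp (s - a) * r ^ 2) / (4 * (1 - Real.exp (s - a))) := by
        field_simp
        ring
    _ ≤ l / 2 := by
        rw [div_le_div_iff₀ (by positivity) two_pos]
        linarith

/-! ### The Harnack inequality. -/

section Harnack

variable {n : ℕ} {N : Type*} [MetricSpace N]
  [ChartedSpace (EuclideanSpace ℝ (Fin n)) N] [IsManifold (𝓡 n) ∞ N]
  [RiemannianBundle (fun x : N ↦ TangentSpace (𝓡 n) x)] [IsRiemannianManifold (𝓡 n) N]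

/-- The arccosine is not differentiable at 1, that is where `u = M`. So `M` is replaced by `a > M`
inside the arccosine, the Lipschitz bound is applied, and `a` tends to `M`. -/
theorem arccos_exp_le_of_norm_grad_sq_le {u : N → ℝ} (hu : ContMDiff (𝓡 n) 𝓘(ℝ, ℝ) 2 u)
    {l M : ℝ} (hl : 0 ≤ l) (hM : ∀ x, u x ≤ M)
    (hg : ∀ x, ‖grad n u x‖ ^ 2 ≤ 2 * l * (Real.exp (M - u x) - 1))
    {p : N} (hp : u p = M) (x : N) :
    Real.arccos (Real.exp ((u x - M) / 2)) ≤ √(l / 2) * dist x p := by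
  have key : ∀ a > M, Real.arccos (Real.exp ((u x - a) / 2)) -
      Real.arccos (Real.exp ((M - a) / 2)) ≤ √(l / 2) * dist x p := by
    intro a ha
    have hlt (z : N) : u z < a := (hM z).trans_lt ha
    have hsmooth : ContMDiff (𝓡 n) 𝓘(ℝ, ℝ) 1
        (fun z ↦ Real.arccos (Real.exp ((u z - a) / 2))) := fun z ↦
      (contDiffAt_arccos_exp (hlt z)).contMDiffAt.comp z ((hu z).of_le one_le_two)
    have hbound (z : N) (v : TangentSpace (𝓡 n) z) :
        |differential n (fun z ↦ Real.arccos (Real.exp ((u z - a) / 2))) z v| ≤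
          (⟨√(l / 2), Real.sqrt_nonneg _⟩ : NNReal) * ‖v‖ := by
      have h1 := mfderiv_comp (I := 𝓡 n) (I' := 𝓘(ℝ, ℝ)) (I'' := 𝓘(ℝ, ℝ)) z
        (hasDerivAt_arccos_exp (hlt z)).differentiableAt.mdifferentiableAt
        (hu.mdifferentiableAt two_ne_zero)
      rw [mfderiv_eq_fderiv] at h1
      have h2 : differential n (fun z ↦ Real.arccos (Real.exp ((u z - a) / 2))) z v =
          fderiv ℝ (fun s : ℝ ↦ Real.arccos (Real.exp ((s - a) / 2))) (u z)
            (differential n u z v : ℝ) :=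
        congrArg (fun L : TangentSpace (𝓡 n) z →L[ℝ] ℝ ↦ L v) h1
      rw [h2, (hasDerivAt_arccos_exp (hlt z)).hasFDerivAt.fderiv,
        ContinuousLinearMap.toSpanSingleton_apply, smul_eq_mul, mul_comm, abs_mul]
      calc _ ≤ |_| * (‖grad n u z‖ * ‖v‖) :=
            mul_le_mul_of_nonneg_left (abs_differential_le u z v) (abs_nonneg _)
        _ = |_| * ‖grad n u z‖ * ‖v‖ := (mul_assoc _ _ _).symm
        _ ≤ _ := mul_le_mul_of_nonneg_right
            (abs_deriv_arccos_exp_mul_le (hM z) ha hl (hg z)) (norm_nonneg _)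
    have h := abs_sub_le_of_differential_le hsmooth hbound x p
    rw [hp] at h
    exact (le_abs_self _).trans h
  have hlim : Tendsto (fun a : ℝ ↦ Real.arccos (Real.exp ((u x - a) / 2)) -
      Real.arccos (Real.exp ((M - a) / 2))) (𝓝[>] M)
      (𝓝 (Real.arccos (Real.exp ((u x - M) / 2)) - Real.arccos (Real.exp ((M - M) / 2)))) := by
    have hc : Continuous (fun a : ℝ ↦ Real.arccos (Real.exp ((u x - a) / 2)) -
      Real.arccos (Real.exp ((M - a) / 2))) := by fun_prop
    exact (hc.tendsto M).mono_left nhdsWithin_le_nhds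
  have h := le_of_tendsto hlim (eventually_nhdsWithin_of_forall fun a ha ↦ key a ha)
  simpa using h

/-- The Harnack inequality for solutions. -/
theorem le_add_of_norm_grad_sq_le [CompactSpace N] {u : N → ℝ}
    (hu : ContMDiff (𝓡 n) 𝓘(ℝ, ℝ) 2 u) {l M : ℝ} (hl : 0 ≤ l) (hM : ∀ x, u x ≤ M)
    (hg : ∀ x, ‖grad n u x‖ ^ 2 ≤ 2 * l * (Real.exp (M - u x) - 1))
    (hD : √(l / 2) * Metric.diam (univ : Set N) < Real.pi / 2) {p : N} (hp : u p = M) (x : N) :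
    M ≤ u x - 2 * Real.log (Real.cos (√(l / 2) * Metric.diam (univ : Set N))) := by
  set d := √(l / 2) * Metric.diam (univ : Set N) with hd
  have hd0 : 0 ≤ d := mul_nonneg (Real.sqrt_nonneg _) Metric.diam_nonneg
  have h1 : Real.arccos (Real.exp ((u x - M) / 2)) ≤ d :=
    (arccos_exp_le_of_norm_grad_sq_le hu hl hM hg hp x).trans
      (mul_le_mul_of_nonneg_left (Metric.dist_le_diam_of_mem isCompact_univ.isBounded
        (mem_univ x) (mem_univ p)) (Real.sqrt_nonneg _))
  have hcos : 0 < Real.cos d := Real.cos_pos_of_mem_Ioo ⟨by linarith [Real.pi_pos], hD⟩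
  have h2 := Real.cos_le_cos_of_nonneg_of_le_pi (Real.arccos_nonneg _)
    (by linarith [Real.pi_pos]) h1
  rw [Real.cos_arccos (by linarith [Real.exp_pos ((u x - M) / 2)])
    (Real.exp_le_one_iff.2 (by linarith [hM x])), ← Real.log_le_iff_le_exp hcos] at h2
  linarith

end Harnack

/-! ### Bounds at the extrema, and the conclusion. -/

/-- At an extremum the equation compares with the determinant of a multiple of the metric, whose
`n`-th root is that multiple: `c` from below at the minimum, `l` from above at the maximum. -/
theorem one_sided_bounds {n : ℕ} (hn : 1 ≤ n) {N : Type*} [TopologicalSpace N]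
    [ChartedSpace (EuclideanSpace ℝ (Fin n)) N] [IsManifold (𝓡 n) ∞ N]
    [RiemannianBundle (fun x : N ↦ TangentSpace (𝓡 n) x)]
    [IsContMDiffRiemannianBundle (𝓡 n) ∞ (EuclideanSpace ℝ (Fin n))
      (fun x : N ↦ TangentSpace (𝓡 n) x)]
    {S : TwoTensor n N}
    (hsymm : ∀ (x : N) (v w : TangentSpace (𝓡 n) x), S x v w = S x w v)
    {u : N → ℝ} (hu : IsSolution S u) {c l : ℝ} (hc : 0 < c) (hl : 0 < l)
    (hSc : ∀ (x : N) (v : TangentSpace (𝓡 n) x), c * ‖v‖ ^ 2 ≤ S x v v)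
    (hSl : ∀ (x : N) (v : TangentSpace (𝓡 n) x), S x v v ≤ l * ‖v‖ ^ 2)
    (hA : ∀ x, IsPosDefAt (conformalHessian S u) x) {p q : N} (hp : ∀ x, u x ≤ u p)
    (hq : ∀ x, u q ≤ u x) :
    Real.log c ≤ -2 * u q ∧ -2 * u p ≤ Real.log l := by
  have hrank (x : N) : Module.finrank ℝ (TangentSpace (𝓡 n) x) = n :=
    finrank_euclideanSpace_fin (𝕜 := ℝ) (n := n)
  have hn0 : n ≠ 0 := by omega
  have hroot {a : ℝ} (ha : 0 < a) : (a ^ n) ^ (1 / n : ℝ) = a := by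
    rw [one_div, Real.pow_rpow_inv_natCast ha.le hn0]
  have hA0 (x : N) (v : TangentSpace (𝓡 n) x) : 0 ≤ conformalHessian S u x v v := by
    by_cases hv : v = 0
    · simp [hv]
    · exact (hA x v hv).le
  constructor
  · rw [Real.log_le_iff_le_exp hc, ← (hu.2 q).2, ← hroot hc]
    refine Real.rpow_le_rpow (by positivity) ?_ (by positivity)
    exact pow_le_det_toEndo (conformalHessian_symm hsymm hu.1 q) (hrank q) hc.le
      fun v ↦ (hSc q v).trans (le_conformalHessian_of_isMin hu.1 hq v)
  · rw [Real.le_log_iff_exp_le hl, ← (hu.2 p).2, ← hroot hl]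
    refine Real.rpow_le_rpow (hu.2 p).1 ?_ (by positivity)
    exact det_toEndo_le_pow (conformalHessian_symm hsymm hu.1 p) (hrank p) (hA0 p)
      fun v ↦ (conformalHessian_le_of_isMax hu.1 hp v).trans (hSl p v)

end ConformalDet

theorem mainTheorem8 {n : ℕ} (hn : 1 ≤ n)
    {N : Type*} [MetricSpace N] [CompactSpace N] [ConnectedSpace N]
    [ChartedSpace (EuclideanSpace ℝ (Fin n)) N] [IsManifold (𝓡 n) ∞ N]
    [RiemannianBundle (fun x : N ↦ TangentSpace (𝓡 n) x)]
    [IsContMDiffRiemannianBundle (𝓡 n) ∞ (EuclideanSpace ℝ (Fin n))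
      (fun x : N ↦ TangentSpace (𝓡 n) x)]
    [IsRiemannianManifold (𝓡 n) N]
    (S : ConformalDet.TwoTensor n N)
    (hS_cont : ConformalDet.IsContinuousTensor S)
    (hS_symm : ∀ (x : N) (v w : TangentSpace (𝓡 n) x), S x v w = S x w v)
    (hS_pos : ∀ (x : N) (v : TangentSpace (𝓡 n) x), v ≠ 0 → 0 < S x v v)
    (hSD : ConformalDet.lambdaMax S * Metric.diam (Set.univ : Set N) ^ 2 < Real.pi ^ 2 / 2) :
    ∃ C : ℝ, ∀ u : N → ℝ, ConformalDet.IsSolution S u → ∀ x : N, |u x| ≤ C := by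
  obtain ⟨c, hc, hSc⟩ := ConformalDet.exists_pos_le_of_posDef hS_cont hS_pos
  have hSl := ConformalDet.le_lambdaMax hS_cont hS_symm hS_pos
  set l := ConformalDet.lambdaMax S with hl_def
  -- Here `1 ≤ n` provides a nonzero tangent vector.
  have hl : 0 < l := by
    obtain ⟨x⟩ : Nonempty N := inferInstance
    have : Nonempty (Fin n) := ⟨⟨0, hn⟩⟩
    obtain ⟨v, hv⟩ := exists_ne (0 : EuclideanSpace ℝ (Fin n))
    have h1 := (hS_pos x v hv).trans_le (hSl x v)
    exact pos_of_mul_pos_left h1 (sq_nonneg _)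
  set d := √(l / 2) * Metric.diam (Set.univ : Set N) with hd
  have hD : d < Real.pi / 2 := by
    -- Squared, the claim is l D² / 2 < π² / 4, which is the hypothesis.
    refine lt_of_pow_lt_pow_left₀ 2 (by positivity) ?_
    rw [hd, mul_pow, Real.sq_sqrt (by positivity)]
    linarith
  set R := -2 * Real.log (Real.cos d) with hR
  -- With max u ≤ min u + R, min u ≤ -(log c)/2 and max u ≥ -(log l)/2, all values of u lie between
  -- -(log l)/2 - R and -(log c)/2 + R.
  refine ⟨|Real.log c| + |Real.log l| + |R|, fun u hu x ↦ ?_⟩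
  have hA := ConformalDet.conformalHessian_isPosDefAt hn hS_cont hS_symm hS_pos hu
  obtain ⟨p, -, hp⟩ := isCompact_univ.exists_isMaxOn Set.univ_nonempty
    hu.1.continuous.continuousOn
  obtain ⟨q, -, hq⟩ := isCompact_univ.exists_isMinOn Set.univ_nonempty
    hu.1.continuous.continuousOn
  have hp' : ∀ x, u x ≤ u p := fun x ↦ hp (Set.mem_univ x)
  have hq' : ∀ x, u q ≤ u x := fun x ↦ hq (Set.mem_univ x)
  obtain ⟨h1, h2⟩ := ConformalDet.one_sided_bounds hn hS_symm hu hc hl hSc hSl hA hp' hq'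
  have h3 := ConformalDet.le_add_of_norm_grad_sq_le hu.1 hl.le hp'
    (ConformalDet.norm_grad_sq_le hu.1 hA hl.le hSl hp') hD rfl q
  rw [abs_le]
  constructor <;>
    linarith [hp' x, hq' x, neg_abs_le (Real.log c), le_abs_self (Real.log l), le_abs_self R,
      abs_nonneg (Real.log c), abs_nonneg (Real.log l)]
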